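/- Manifolds are Hausdorff, second countable and without boundary. Let $\mathcal M$ and $\mathcal N$ be $C^2$ manifolds, $M:=\dim\mathcal M$, let $L\ge 1$ and $h\ge 0$ be integers with $h+1\le M$. For $r\in\{0,1\}$, $\mathrm{Mat}_L C^r\mathcal F^h$ denotes the $L\times L$ matrices whose entries are differential $h$-forms of class $C^r$, i.e. forms whose coefficients in every $C^2$ chart are of class $C^r$; exterior derivative $d$, pullback and integral are taken entrywise, and $(\lambda\wedge\varphi)^{(ij)}=\sum_s\lambda^{(is)}\wedge\varphi^{(sj)}$. A form $\mu\in\mathrm{Mat}_L C^0\mathcal F^h(\mathcal M)$ has the distributional exterior derivative $\delta\mu\in\mathrm{Mat}_L C^0\mathcal F^{h+1}(\mathcal M)$ if $$\int_{U}\mu\wedge d\varphi=(-1)^{h+1}\int_{U}\delta\mu\wedge\varphi$$ for every oriented open set $U\subset\mathcal M$ and every matrix $\varphi$ of $(M-h-1)$-forms of class $C^1$ with compact support contained in $U$ (if $\mathcal M$ is oriented, it is equivalent to require this for $U=\mathcal M$ only). A point $P\in\mathcal M$ is an $m$-density point of $\mathcal E\subset\mathcal M$ if there is a $C^1$ chart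 $(\mathcal W,\Phi)$ of $\mathcal M$ with $P\in\mathcal W$ and $$\mathcal L^M\bigl(B_r(\Phi(P))\setminus\Phi(\mathcal E\cap\mathcal W)\bigr)=o(r^m)\qquad(r\to0+);$$ the set of these points is denoted by $\mathcal E^{(m)}$. Let $f:\mathcal M\to\mathcal N$ be a map of class $C^1$, let $\omega\in\mathrm{Mat}_L C^1\mathcal F^h(\mathcal N)$, and let $\mu\in\mathrm{Mat}_L C^0\mathcal F^h(\mathcal M)$ have the distributional exterior derivative $\delta\mu\in\mathrm{Mat}_L C^0\mathcal F^{h+1}(\mathcal M)$. Put $$\mathcal A:=\{P\in\mathcal M\mid \mu_P=(f^*\omega)_P\}.$$ Then $(\delta\mu)_Q=(f^*d\omega)_Q$ for every $Q\in\mathcal A^{(M+1)}$. -/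

import Mathlib

open scoped Manifold Topology

noncomputable section

namespace ManifoldForms

/-- The exterior product of alternating forms (shuffle convention: `(dx ∧ dy)(e₁, e₂) = 1`),
with the total degree `m = k + l` given by an equation. -/
def wedge {E : Type*} [AddCommGroup E] [Module ℝ E] [TopologicalSpace E] {k l m : ℕ} (hm : k + l = m)
    (a : E [⋀^Fin k]→L[ℝ] ℝ) (b : E [⋀^Fin l]→L[ℝ] ℝ) : E [⋀^Fin m]→L[ℝ] ℝ :=
  { ((LinearMap.mul' ℝ ℝ).compAlternatingMap
      (a.toAlternatingMap.domCoprod b.toAlternatingMap)).domDomCongr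
        (finSumFinEquiv.trans (finCongr hm)) with
    cont := by
      change Continuous fun v : Fin m → E =>
        (LinearMap.mul' ℝ ℝ) ((a.toAlternatingMap.domCoprod b.toAlternatingMap)
          fun i => v ((finSumFinEquiv.trans (finCongr hm)) i))
      simp only [AlternatingMap.domCoprod_apply, sum_apply, map_sum]
      refine continuous_finsetSum _ fun σ _ => ?_
      induction σ using Quotient.inductionOn' with
      | h σ =>
        have hc : Continuous fun v : Fin m → E =>
            (Equiv.Perm.sign σ : ℤ) •
              (a (fun i => v (finCongr hm (finSumFinEquiv (σ (Sum.inl i))))) *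
                b (fun i => v (finCongr hm (finSumFinEquiv (σ (Sum.inr i)))))) := by
          have ha : Continuous fun v : Fin m → E =>
              fun i => v (finCongr hm (finSumFinEquiv (σ (Sum.inl i)))) :=
            continuous_pi fun i => continuous_apply _
          have hb : Continuous fun v : Fin m → E =>
              fun i => v (finCongr hm (finSumFinEquiv (σ (Sum.inr i)))) :=
            continuous_pi fun i => continuous_apply _
          exact ((a.cont.comp ha).mul (b.cont.comp hb)).const_smul (Equiv.Perm.sign σ : ℤ)
        refine hc.congr fun v => ?_
        rw [AlternatingMap.domCoprod.summand_mk'', Units.smul_def, smul_apply, map_zsmul]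
        rfl }

/-- Differential `h`-forms, of no regularity, on an `n`-dimensional manifold without boundary. -/
abbrev Form (n : ℕ) (M : Type*) [TopologicalSpace M]
    [ChartedSpace (EuclideanSpace ℝ (Fin n)) M] (h : ℕ) : Type _ :=
  (p : M) → TangentSpace (𝓡 n) p [⋀^Fin h]→L[ℝ] ℝ

/-- `L × L` matrices of differential forms. -/
abbrev MatForm (L n : ℕ) (M : Type*) [TopologicalSpace M]
    [ChartedSpace (EuclideanSpace ℝ (Fin n)) M] (h : ℕ) : Type _ :=
  Matrix (Fin L) (Fin L) (Form n M h)

section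

variable {n : ℕ} {M : Type*} [TopologicalSpace M] [ChartedSpace (EuclideanSpace ℝ (Fin n)) M]
variable {n' : ℕ} {N : Type*} [TopologicalSpace N] [ChartedSpace (EuclideanSpace ℝ (Fin n')) N]
variable {h L : ℕ}

/-- The pullback `f^* ω`. -/
def pullback (f : M → N) (ω : Form n' N h) : Form n M h :=
  fun p => (ω (f p)).compContinuousLinearMap (mfderiv (𝓡 n) (𝓡 n') f p)

/-- The representation `(e⁻¹)^* ω` of a form in a chart `e`, meaningful on `e.target`. -/
def coordRep (e : OpenPartialHomeomorph M (EuclideanSpace ℝ (Fin n))) (ω : Form n M h) :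
    EuclideanSpace ℝ (Fin n) → EuclideanSpace ℝ (Fin n) [⋀^Fin h]→L[ℝ] ℝ :=
  fun y => (ω (e.symm y)).compContinuousLinearMap (mfderiv (𝓡 n) (𝓡 n) e.symm y)

/-- `ω` is of class `C^r` on the open set `U`: its representations in all charts of the `C^2`
structure are of class `C^r` there. It is only used with `r ≤ 1`. -/
def IsCrOn (r : WithTop ℕ∞) (ω : Form n M h) (U : Set M) : Prop :=
  ∀ e ∈ IsManifold.maximalAtlas (𝓡 n) 2 M,
    ContDiffOn ℝ r (coordRep e ω) (e.target ∩ e.symm ⁻¹' U)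

/-- `ω` is a form of class `C^r` on `M`. -/
def IsCr (r : WithTop ℕ∞) (ω : Form n M h) : Prop := IsCrOn r ω Set.univ

/-- The support of a form. -/
def supp (ω : Form n M h) : Set M := closure {p | ω p ≠ 0}

/-- The exterior derivative of a form of class `C^1`, computed at `p` in the preferred chart
around `p`. -/
def extD (ω : Form n M h) : Form n M (h + 1) :=
  fun p => (extDeriv (coordRep (chartAt (EuclideanSpace ℝ (Fin n)) p) ω)
    (chartAt (EuclideanSpace ℝ (Fin n)) p p)).compContinuousLinearMap
      (mfderiv (𝓡 n) (𝓡 n) (chartAt (EuclideanSpace ℝ (Fin n)) p) p)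

/-- The exterior product of matrix valued forms. -/
def matWedge {k l m : ℕ} (hm : k + l = m) (a : MatForm L n M k) (b : MatForm L n M l) :
    MatForm L n M m :=
  fun i j p => ∑ s : Fin L, wedge (E := TangentSpace (𝓡 n) p) hm (a i s p) (b s j p)

/-- The nowhere vanishing continuous `n`-form `σ` on the open set `U` orients `U`: a basis
`v` of `T_pM`, `p ∈ U`, is positive if `σ_p(v) > 0`. -/
def IsOrientationOn (σ : Form n M n) (U : Set M) : Prop :=
  IsOpen U ∧ IsCrOn 0 σ U ∧ ∀ p ∈ U, σ p ≠ 0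

/-- The value on the standard basis of the representation in `e` of an `n`-form `α`, that is, the
function `F` with `(e⁻¹)^* α = F dx₁ ∧ … ∧ dxₙ`. -/
def coeff (e : OpenPartialHomeomorph M (EuclideanSpace ℝ (Fin n))) (α : Form n M n)
    (y : EuclideanSpace ℝ (Fin n)) : ℝ :=
  coordRep e α y fun i => EuclideanSpace.basisFun (Fin n) ℝ i

theorem exists_partitionOfUnity (n : ℕ) (M : Type*) [TopologicalSpace M]
    [ChartedSpace (EuclideanSpace ℝ (Fin n)) M] [T2Space M] [SecondCountableTopology M] :
    ∃ ρ : PartitionOfUnity M M,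
      ρ.IsSubordinate fun p => (chartAt (EuclideanSpace ℝ (Fin n)) p).source := by
  have : LocallyCompactSpace M := ChartedSpace.locallyCompactSpace (EuclideanSpace ℝ (Fin n)) M
  exact PartitionOfUnity.exists_isSubordinate isClosed_univ _
    (fun p => (chartAt (EuclideanSpace ℝ (Fin n)) p).open_source)
    (fun p _ => Set.mem_iUnion.2 ⟨p, mem_chart_source _ p⟩)

/-- A continuous partition of unity on `M` subordinate to the preferred charts. -/
def chartPartition (n : ℕ) (M : Type*) [TopologicalSpace M]
    [ChartedSpace (EuclideanSpace ℝ (Fin n)) M] [T2Space M] [SecondCountableTopology M] :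
    PartitionOfUnity M M :=
  (exists_partitionOfUnity n M).choose

/-- The integral of a continuous `n`-form `α` whose compact support lies in an open set oriented
by `σ`: the form is cut into pieces by a partition of unity, and each piece is integrated in its
chart, with the sign `±1` according to whether the chart is positive at the point. -/
def integral [T2Space M] [SecondCountableTopology M] (σ α : Form n M n) : ℝ :=
  ∑ᶠ p : M, ∫ y in (chartAt (EuclideanSpace ℝ (Fin n)) p).target,
    chartPartition n M p ((chartAt (EuclideanSpace ℝ (Fin n)) p).symm y) *
      (SignType.sign (coeff (chartAt (EuclideanSpace ℝ (Fin n)) p) σ y) : ℝ) *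
        coeff (chartAt (EuclideanSpace ℝ (Fin n)) p) α y

/-- `δ` is the distributional exterior derivative of `lam`:
`∫_U lam ∧ dφ = (-1)^(h+1) ∫_U δ ∧ φ` for every oriented open set `U` and every matrix valued
test form `φ` of class `C^1` and of degree `q = n - h - 1` with compact support in `U`. If `M` is
oriented, this amounts to the same identity for `U = M` alone. -/
def IsDED [T2Space M] [SecondCountableTopology M] (lam : MatForm L n M h)
    (δ : MatForm L n M (h + 1)) : Prop :=
  ∀ (U : Set M) (σ : Form n M n), IsOrientationOn σ U →
    ∀ (q : ℕ) (hq : (h + 1) + q = n) (φ : MatForm L n M q),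
      (∀ i j, IsCr 1 (φ i j) ∧ IsCompact (supp (φ i j)) ∧ supp (φ i j) ⊆ U) →
        ∀ i j,
          integral σ (matWedge (show h + (q + 1) = n by omega) lam (φ.map extD) i j) =
            (-1) ^ (h + 1) * integral σ (matWedge hq δ φ i j)

/-- The set of `m`-density points of `A` relative to `M`. -/
def densityPoints (n : ℕ) {M : Type*} [TopologicalSpace M]
    [ChartedSpace (EuclideanSpace ℝ (Fin n)) M] (m : ℝ) (A : Set M) : Set M :=
  {p | ∃ e ∈ IsManifold.maximalAtlas (𝓡 n) 1 M, p ∈ e.source ∧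
    (fun r : ℝ => (MeasureTheory.volume (Metric.ball (e p) r \ e '' (A ∩ e.source))).toReal)
      =o[𝓝[>] 0] fun r : ℝ => r ^ m}

end

end ManifoldForms

end

noncomputable section

namespace ManifoldForms

section Wedge

variable {E : Type*} [AddCommGroup E] [Module ℝ E] [TopologicalSpace E] {k l m : ℕ}

theorem factorial_mul_wedge_apply (hm : k + l = m)
    (a : E [⋀^Fin k]→L[ℝ] ℝ) (b : E [⋀^Fin l]→L[ℝ] ℝ) (v : Fin m → E) :
    ((k.factorial : ℝ) * l.factorial) * wedge hm a b v =
      ∑ σ : Equiv.Perm (Fin k ⊕ Fin l), ((Equiv.Perm.sign σ : ℤ) : ℝ) *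
        (a (fun i => v (finCongr hm (finSumFinEquiv (σ (Sum.inl i))))) *
          b (fun i => v (finCongr hm (finSumFinEquiv (σ (Sum.inr i)))))) := by
  have h := congrArg (fun F => LinearMap.mul' ℝ ℝ
    (F fun i => v (finCongr hm (finSumFinEquiv i))))
    (MultilinearMap.domCoprod_alternization_eq a.toAlternatingMap b.toAlternatingMap)
  simp only [MultilinearMap.alternatization_apply, map_sum, Fintype.card_fin,
    AlternatingMap.smul_apply, map_nsmul] at h
  rw [nsmul_eq_mul] at h
  push_cast at h
  refine h.symm.trans (Finset.sum_congr rfl fun σ _ => ?_)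
  rw [Units.smul_def, map_zsmul, zsmul_eq_mul]
  rfl

theorem wedge_apply (hm : k + l = m)
    (a : E [⋀^Fin k]→L[ℝ] ℝ) (b : E [⋀^Fin l]→L[ℝ] ℝ) (v : Fin m → E) :
    wedge hm a b v = ((k.factorial : ℝ) * l.factorial)⁻¹ *
      ∑ σ : Equiv.Perm (Fin k ⊕ Fin l), ((Equiv.Perm.sign σ : ℤ) : ℝ) *
        (a (fun i => v (finCongr hm (finSumFinEquiv (σ (Sum.inl i))))) *
          b (fun i => v (finCongr hm (finSumFinEquiv (σ (Sum.inr i)))))) := by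
  rw [← factorial_mul_wedge_apply, inv_mul_cancel_left₀]
  positivity

theorem wedge_add_left (hm : k + l = m) (a a' : E [⋀^Fin k]→L[ℝ] ℝ) (b : E [⋀^Fin l]→L[ℝ] ℝ) :
    wedge hm (a + a') b = wedge hm a b + wedge hm a' b := by
  ext v
  simp [wedge_apply, add_mul, mul_add, Finset.sum_add_distrib]

theorem wedge_smul_left (hm : k + l = m) (r : ℝ) (a : E [⋀^Fin k]→L[ℝ] ℝ)
    (b : E [⋀^Fin l]→L[ℝ] ℝ) : wedge hm (r • a) b = r • wedge hm a b := by
  ext v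
  simp only [wedge_apply, ContinuousAlternatingMap.smul_apply, smul_eq_mul, Finset.mul_sum]
  exact Finset.sum_congr rfl fun σ _ => by ring

theorem wedge_smul_right (hm : k + l = m) (r : ℝ) (a : E [⋀^Fin k]→L[ℝ] ℝ)
    (b : E [⋀^Fin l]→L[ℝ] ℝ) : wedge hm a (r • b) = r • wedge hm a b := by
  ext v
  simp only [wedge_apply, ContinuousAlternatingMap.smul_apply, smul_eq_mul, Finset.mul_sum]
  exact Finset.sum_congr rfl fun σ _ => by ring

theorem wedge_zero_right (hm : k + l = m) (a : E [⋀^Fin k]→L[ℝ] ℝ) :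
    wedge hm a (0 : E [⋀^Fin l]→L[ℝ] ℝ) = 0 := by
  ext v
  simp [wedge_apply]

theorem wedge_compContinuousLinearMap {E' : Type*} [AddCommGroup E'] [Module ℝ E']
    [TopologicalSpace E'] (hm : k + l = m) (a : E [⋀^Fin k]→L[ℝ] ℝ)
    (b : E [⋀^Fin l]→L[ℝ] ℝ) (g : E' →L[ℝ] E) :
    (wedge hm a b).compContinuousLinearMap g =
      wedge hm (a.compContinuousLinearMap g) (b.compContinuousLinearMap g) := by
  ext v
  simp only [wedge_apply, ContinuousAlternatingMap.compContinuousLinearMap_apply]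
  rfl

/-- Moving the block structure of the sum over permutations by a fixed permutation. -/
theorem sum_sign_mul_comp_perm {V : Type*} (π : Equiv.Perm (Fin m)) (G : (Fin m → V) → ℝ)
    (v : Fin m → V) :
    ∑ σ : Equiv.Perm (Fin m), ((Equiv.Perm.sign σ : ℤ) : ℝ) * G (fun i => v (σ (π i))) =
      ((Equiv.Perm.sign π : ℤ) : ℝ) *
        ∑ σ : Equiv.Perm (Fin m), ((Equiv.Perm.sign σ : ℤ) : ℝ) * G (fun i => v (σ i)) := by
  rw [Finset.mul_sum]
  refine Fintype.sum_equiv (Equiv.mulRight π) _ _ fun σ => ?_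
  rw [← mul_assoc]
  congr 1
  have : ((Equiv.Perm.sign π : ℤ) : ℝ) * ((Equiv.Perm.sign π : ℤ) : ℝ) = 1 := by
    rcases Int.units_eq_one_or (Equiv.Perm.sign π) with h | h <;> simp [h]
  simp only [Equiv.coe_mulRight, Equiv.Perm.sign_mul, Units.val_mul, Int.cast_mul]
  linear_combination (-((Equiv.Perm.sign σ : ℤ) : ℝ)) * this

end Wedge

section Covector

variable {E : Type*} [NormedAddCommGroup E] [NormedSpace ℝ E] {k l m : ℕ}

/-- The exterior product `ℓ ∧ a` of a covector with a form. -/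
def covecWedge (ℓ : E →L[ℝ] ℝ) (a : E [⋀^Fin k]→L[ℝ] ℝ) : E [⋀^Fin (k + 1)]→L[ℝ] ℝ :=
  ContinuousAlternatingMap.alternatizeUncurryFin (ℓ.smulRight a)

theorem covecWedge_apply (ℓ : E →L[ℝ] ℝ) (a : E [⋀^Fin k]→L[ℝ] ℝ) (v : Fin (k + 1) → E) :
    covecWedge ℓ a v =
      ∑ i : Fin (k + 1), (-1) ^ (i : ℕ) * (ℓ (v i) * a (fun j => v (i.succAbove j))) := by
  simp only [covecWedge, ContinuousAlternatingMap.alternatizeUncurryFin_apply]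
  refine Finset.sum_congr rfl fun i _ => ?_
  rw [zsmul_eq_mul]
  push_cast
  rfl

theorem wedge_covecWedge_right (hm : k + (l + 1) = m) (ℓ : E →L[ℝ] ℝ)
    (a : E [⋀^Fin k]→L[ℝ] ℝ) (c : E [⋀^Fin l]→L[ℝ] ℝ) (v : Fin m → E) :
    wedge hm a (covecWedge ℓ c) v = ((k.factorial : ℝ) * l.factorial)⁻¹ *
      ∑ σ : Equiv.Perm (Fin m), ((Equiv.Perm.sign σ : ℤ) : ℝ) *
        (a (fun i => v (σ ⟨i, by omega⟩)) * (ℓ (v (σ ⟨k, by omega⟩)) *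
          c (fun i => v (σ ⟨k + 1 + i, by omega⟩)))) := by
  have key : ∀ i : Fin (l + 1), ∑ σ : Equiv.Perm (Fin k ⊕ Fin (l + 1)),
      ((Equiv.Perm.sign σ : ℤ) : ℝ) *
        (a (fun i => v (finCongr hm (finSumFinEquiv (σ (Sum.inl i))))) * ((-1) ^ (i : ℕ) *
          (ℓ (v (finCongr hm (finSumFinEquiv (σ (Sum.inr i))))) *
          c (fun j => v (finCongr hm (finSumFinEquiv (σ (Sum.inr (i.succAbove j))))))))) =
      ∑ σ : Equiv.Perm (Fin k ⊕ Fin (l + 1)), ((Equiv.Perm.sign σ : ℤ) : ℝ) *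
        (a (fun i => v (finCongr hm (finSumFinEquiv (σ (Sum.inl i))))) *
          (ℓ (v (finCongr hm (finSumFinEquiv (σ (Sum.inr 0))))) *
          c (fun i => v (finCongr hm (finSumFinEquiv (σ (Sum.inr i.succ))))))) := by
    intro i
    refine Fintype.sum_equiv (Equiv.mulRight (Equiv.sumCongr 1 i.cycleRange.symm)) _ _ fun σ => ?_
    simp only [Equiv.coe_mulRight, Equiv.Perm.sign_mul, Equiv.Perm.mul_apply,
      Equiv.sumCongr_apply, Sum.map_inl, Sum.map_inr, Fin.cycleRange_symm_zero,
      Fin.cycleRange_symm_succ, Equiv.Perm.sign_sumCongr, Equiv.Perm.sign_symm,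
      Fin.sign_cycleRange]
    simp
    ring
  rw [wedge_apply]
  simp only [covecWedge_apply, Finset.mul_sum]
  rw [Finset.sum_comm]
  simp only [← Finset.mul_sum, key, Finset.sum_const, Finset.card_univ, Fintype.card_fin,
    nsmul_eq_mul]
  rw [← mul_assoc]
  congr 1
  · rw [Nat.factorial_succ]
    push_cast
    field_simp
  · refine Fintype.sum_equiv (Equiv.permCongr (finSumFinEquiv.trans (finCongr hm))) _ _
      fun σ => ?_
    rw [Equiv.Perm.sign_permCongr]
    have h1 : ∀ i : Fin k, (⟨i, by omega⟩ : Fin m) =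
      (finSumFinEquiv.trans (finCongr hm)) (Sum.inl i) := fun i => by ext; simp
    have h2 : (⟨k, by omega⟩ : Fin m) =
      (finSumFinEquiv.trans (finCongr hm)) (Sum.inr 0) := by ext; simp
    have h3 : ∀ i : Fin l, (⟨k + 1 + i, by omega⟩ : Fin m) =
      (finSumFinEquiv.trans (finCongr hm)) (Sum.inr i.succ) := fun i => by ext; simp; omega
    simp only [h1, h2, h3, Equiv.permCongr_apply, Equiv.symm_apply_apply]
    rfl

theorem wedge_covecWedge_left (hm : k + 1 + l = m) (ℓ : E →L[ℝ] ℝ)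
    (a : E [⋀^Fin k]→L[ℝ] ℝ) (c : E [⋀^Fin l]→L[ℝ] ℝ) (v : Fin m → E) :
    wedge hm (covecWedge ℓ a) c v = ((k.factorial : ℝ) * l.factorial)⁻¹ *
      ∑ σ : Equiv.Perm (Fin m), ((Equiv.Perm.sign σ : ℤ) : ℝ) *
        (a (fun i => v (σ ⟨i + 1, by omega⟩)) * (ℓ (v (σ ⟨0, by omega⟩)) *
          c (fun i => v (σ ⟨k + 1 + i, by omega⟩)))) := by
  have key : ∀ i : Fin (k + 1), ∑ σ : Equiv.Perm (Fin (k + 1) ⊕ Fin l),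
      ((Equiv.Perm.sign σ : ℤ) : ℝ) *
        (c (fun i => v (finCongr hm (finSumFinEquiv (σ (Sum.inr i))))) * ((-1) ^ (i : ℕ) *
          (ℓ (v (finCongr hm (finSumFinEquiv (σ (Sum.inl i))))) *
          a (fun j => v (finCongr hm (finSumFinEquiv (σ (Sum.inl (i.succAbove j))))))))) =
      ∑ σ : Equiv.Perm (Fin (k + 1) ⊕ Fin l), ((Equiv.Perm.sign σ : ℤ) : ℝ) *
        (c (fun i => v (finCongr hm (finSumFinEquiv (σ (Sum.inr i))))) *
          (ℓ (v (finCongr hm (finSumFinEquiv (σ (Sum.inl 0))))) *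
          a (fun i => v (finCongr hm (finSumFinEquiv (σ (Sum.inl i.succ))))))) := by
    intro i
    refine Fintype.sum_equiv (Equiv.mulRight (Equiv.sumCongr i.cycleRange.symm 1)) _ _ fun σ => ?_
    simp only [Equiv.coe_mulRight, Equiv.Perm.sign_mul, Equiv.Perm.mul_apply,
      Equiv.sumCongr_apply, Sum.map_inl, Sum.map_inr, Fin.cycleRange_symm_zero,
      Fin.cycleRange_symm_succ, Equiv.Perm.sign_sumCongr, Equiv.Perm.sign_symm,
      Fin.sign_cycleRange]
    simp
    ring
  rw [wedge_apply]
  simp only [covecWedge_apply]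
  simp only [mul_comm _ (c _), Finset.mul_sum]
  rw [Finset.sum_comm]
  simp only [← Finset.mul_sum, key, Finset.sum_const, Finset.card_univ, Fintype.card_fin,
    nsmul_eq_mul]
  rw [← mul_assoc]
  congr 1
  · rw [Nat.factorial_succ]
    push_cast
    field_simp
  · refine Fintype.sum_equiv (Equiv.permCongr (finSumFinEquiv.trans (finCongr hm))) _ _
      fun σ => ?_
    rw [Equiv.Perm.sign_permCongr]
    have h1 : ∀ i : Fin k, (⟨i + 1, by omega⟩ : Fin m) =
      (finSumFinEquiv.trans (finCongr hm)) (Sum.inl i.succ) := fun i => by ext; simp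
    have h2 : (⟨0, by omega⟩ : Fin m) =
      (finSumFinEquiv.trans (finCongr hm)) (Sum.inl 0) := by ext; simp
    have h3 : ∀ i : Fin l, (⟨k + 1 + i, by omega⟩ : Fin m) =
      (finSumFinEquiv.trans (finCongr hm)) (Sum.inr i) := fun i => by ext; simp
    simp only [h1, h2, h3, Equiv.permCongr_apply, Equiv.symm_apply_apply]
    simp only [Equiv.trans_apply]
    ring

theorem wedge_covecWedge (hm : k + (l + 1) = m) (hm' : k + 1 + l = m) (ℓ : E →L[ℝ] ℝ)
    (a : E [⋀^Fin k]→L[ℝ] ℝ) (c : E [⋀^Fin l]→L[ℝ] ℝ) :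
    wedge hm a (covecWedge ℓ c) = (-1 : ℝ) ^ k • wedge hm' (covecWedge ℓ a) c := by
  ext v
  obtain ⟨m, rfl⟩ : ∃ m', m = m' + 1 := ⟨k + l, by omega⟩
  rw [ContinuousAlternatingMap.smul_apply, wedge_covecWedge_right, wedge_covecWedge_left,
    smul_eq_mul, mul_left_comm]
  congr 1
  let K : Fin (m + 1) := ⟨k, by omega⟩
  let G : (Fin (m + 1) → E) → ℝ := fun w => a (fun i => w ⟨i + 1, by omega⟩) *
    (ℓ (w ⟨0, by omega⟩) * c (fun i => w ⟨k + 1 + i, by omega⟩))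
  have h := sum_sign_mul_comp_perm K.cycleRange.symm G v
  simp only [Equiv.Perm.sign_symm, Fin.sign_cycleRange] at h
  have h0 : K.cycleRange.symm ⟨0, by omega⟩ = K := Fin.cycleRange_symm_zero K
  have h1 : ∀ i : Fin k, K.cycleRange.symm ⟨i + 1, by omega⟩ = ⟨i, by omega⟩ := fun i => by
    have := Fin.cycleRange_symm_succ K ⟨i, by omega⟩
    simp only [Fin.succ_mk] at this
    rw [this, Fin.succAbove_of_castSucc_lt _ _ (by simp [K, Fin.lt_def])]
    rfl
  have h2 : ∀ i : Fin l, K.cycleRange.symm ⟨k + 1 + i, by omega⟩ = ⟨k + 1 + i, by omega⟩ :=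
    fun i => by
    have := Fin.cycleRange_symm_succ K ⟨k + i, by omega⟩
    simp only [Fin.succ_mk] at this
    rw [Fin.succAbove_of_le_castSucc _ _ (by simp [K, Fin.le_def])] at this
    simpa [add_right_comm] using this
  simp only [G, h0, h1, h2] at h
  rw [h]
  simp [K]

/-- The map `a ↦ (a ∧ c)(v)` as a continuous linear functional. -/
def wedgeCLM (hm : k + l = m) (c : E [⋀^Fin l]→L[ℝ] ℝ) (v : Fin m → E) :
    (E [⋀^Fin k]→L[ℝ] ℝ) →L[ℝ] ℝ where
  toFun a := wedge hm a c v
  map_add' a a' := by rw [wedge_add_left]; rfl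
  map_smul' r a := by rw [wedge_smul_left]; rfl
  cont := by
    simp only [wedge_apply]
    refine continuous_const.mul (continuous_finsetSum _ fun σ _ => continuous_const.mul ?_)
    exact (ContinuousAlternatingMap.apply ℝ E ℝ _).continuous.mul continuous_const

@[simp]
theorem wedgeCLM_apply (hm : k + l = m) (c : E [⋀^Fin l]→L[ℝ] ℝ) (v : Fin m → E)
    (a : E [⋀^Fin k]→L[ℝ] ℝ) : wedgeCLM hm c v a = wedge hm a c v := rfl

end Covector

section Nondegenerate

variable {k l n : ℕ}

/-- The form `w ↦ det (w i (p j))`, that is `dx_{p 0} ∧ … ∧ dx_{p (l - 1)}`. -/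
def coordForm (p : Fin l → Fin n) : EuclideanSpace ℝ (Fin n) [⋀^Fin l]→L[ℝ] ℝ :=
  { (Matrix.detRowAlternating (n := Fin l) (R := ℝ)).compLinearMap
      (LinearMap.pi fun j =>
        (EuclideanSpace.proj (p j) : EuclideanSpace ℝ (Fin n) →L[ℝ] ℝ).toLinearMap) with
    cont := by
      change Continuous fun w : Fin l → EuclideanSpace ℝ (Fin n) =>
        Matrix.det (Matrix.of fun i j => w i (p j))
      refine Continuous.matrix_det (continuous_matrix fun i j => ?_)
      simp only [Matrix.of_apply]
      fun_prop }

theorem coordForm_apply (p : Fin l → Fin n) (w : Fin l → EuclideanSpace ℝ (Fin n)) :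
    coordForm p w = Matrix.det (Matrix.of fun i j => w i (p j)) := rfl

theorem eq_zero_of_wedge_eq_zero (hm : k + l = n) (θ : EuclideanSpace ℝ (Fin n) [⋀^Fin k]→L[ℝ] ℝ)
    (h : ∀ c : EuclideanSpace ℝ (Fin n) [⋀^Fin l]→L[ℝ] ℝ,
      wedge hm θ c (fun i => EuclideanSpace.basisFun (Fin n) ℝ i) = 0) : θ = 0 := by
  apply ContinuousAlternatingMap.toAlternatingMap_injective
  refine Module.Basis.ext_alternating (EuclideanSpace.basisFun (Fin n) ℝ).toBasis fun v hv => ?_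
  simp only [OrthonormalBasis.coe_toBasis, ContinuousAlternatingMap.toAlternatingMap_zero,
    AlternatingMap.zero_apply, ContinuousAlternatingMap.coe_toAlternatingMap]
  let ε := finSumFinEquiv.trans (finCongr hm)
  obtain ⟨π, hπ⟩ : ∃ π : Equiv.Perm (Fin k ⊕ Fin l), ∀ i, ε (π (Sum.inl i)) = v i := by
    have hinj : Set.InjOn (Sum.elim (fun i => ε.symm (v i)) Sum.inr : Fin k ⊕ Fin l → Fin k ⊕ Fin l)
        (Set.range Sum.inl) := by
      rintro _ ⟨i, rfl⟩ _ ⟨j, rfl⟩ hij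
      exact congrArg _ (hv (ε.symm.injective hij))
    obtain ⟨g, hg⟩ := Set.MapsTo.exists_equiv_extend_of_card_eq (t := Finset.univ)
      (by simp) (fun i _ => by simp) hinj
    refine ⟨g.trans (Equiv.subtypeUnivEquiv fun x => Finset.mem_univ x), fun i => ?_⟩
    have := hg (Sum.inl i) ⟨i, rfl⟩
    simp only [Equiv.trans_apply, Equiv.subtypeUnivEquiv_apply, this]
    simp
  set e : Fin n → EuclideanSpace ℝ (Fin n) := fun i => EuclideanSpace.basisFun (Fin n) ℝ i with he
  have he_apply : ∀ i j, e i j = if j = i then 1 else 0 := fun i j => by simp [he]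
  let p : Fin l → Fin n := fun j => ε (π (Sum.inr j))
  have hp1 : coordForm p (fun i => e (p i)) = 1 := by
    rw [coordForm_apply, ← Matrix.det_one (n := Fin l)]
    congr 1
    ext i j
    have : p j = p i ↔ i = j := by simp [p, eq_comm]
    simp [he_apply, Matrix.one_apply, this]
  have hw := factorial_mul_wedge_apply hm θ (coordForm p) e
  rw [h, mul_zero] at hw
  set X : ℝ := ((Equiv.Perm.sign π : ℤ) : ℝ) * θ (fun i => e (v i)) with hX
  have hterm : ∀ σ : Equiv.Perm (Fin k ⊕ Fin l), ∃ N : ℝ, 0 ≤ N ∧ (σ = π → N = 1) ∧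
      ((Equiv.Perm.sign σ : ℤ) : ℝ) * (θ (fun i => e (ε (σ (Sum.inl i)))) *
        coordForm p (fun i => e (ε (σ (Sum.inr i))))) = N * X := by
    intro σ
    by_cases hτ : Set.MapsTo (π⁻¹ * σ) (Set.range Sum.inl) (Set.range Sum.inl)
    · obtain ⟨⟨τ₁, τ₂⟩, hτ'⟩ := Equiv.Perm.mem_sumCongrHom_range_of_perm_mapsTo_inl hτ
      obtain rfl : π * Equiv.Perm.sumCongrHom _ _ (τ₁, τ₂) = σ := by rw [hτ']; simp
      refine ⟨1, zero_le_one, fun _ => rfl, ?_⟩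
      have h1 := θ.toAlternatingMap.map_perm (fun i => e (v i)) τ₁
      have h2 := (coordForm p).toAlternatingMap.map_perm (fun i => e (p i)) τ₂
      simp only [ContinuousAlternatingMap.coe_toAlternatingMap, Function.comp_def,
        Units.smul_def, zsmul_eq_mul] at h1 h2
      have h3 : ∀ i, ε ((π * Equiv.Perm.sumCongrHom _ _ (τ₁, τ₂)) (Sum.inl i)) = v (τ₁ i) := by
        intro i; rw [← hπ]; rfl
      have h4 : ∀ i, ε ((π * Equiv.Perm.sumCongrHom _ _ (τ₁, τ₂)) (Sum.inr i)) = p (τ₂ i) :=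
        fun i => rfl
      simp only [h3, h4, h1, h2, hp1, hX]
      have hs : ∀ τ : Fin k ≃ Fin k,
          ((Equiv.Perm.sign τ : ℤ) : ℝ) * ((Equiv.Perm.sign τ : ℤ) : ℝ) = 1 := fun τ => by
        rcases Int.units_eq_one_or (Equiv.Perm.sign τ) with h | h <;> simp [h]
      have hs' : ∀ τ : Fin l ≃ Fin l,
          ((Equiv.Perm.sign τ : ℤ) : ℝ) * ((Equiv.Perm.sign τ : ℤ) : ℝ) = 1 := fun τ => by
        rcases Int.units_eq_one_or (Equiv.Perm.sign τ) with h | h <;> simp [h]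
      rw [Equiv.Perm.sign_mul, Equiv.Perm.sumCongrHom_apply, Equiv.Perm.sign_sumCongr]
      push_cast
      calc _ = ((Equiv.Perm.sign π : ℤ) : ℝ) * θ (fun i => e (v i)) *
            (((Equiv.Perm.sign τ₁ : ℤ) : ℝ) * ((Equiv.Perm.sign τ₁ : ℤ) : ℝ)) *
            (((Equiv.Perm.sign τ₂ : ℤ) : ℝ) * ((Equiv.Perm.sign τ₂ : ℤ) : ℝ)) := by ring
        _ = _ := by rw [hs, hs']; ring
    · refine ⟨0, le_rfl, fun hσ => absurd ?_ hτ, ?_⟩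
      · rw [hσ, inv_mul_cancel]
        exact fun x hx => hx
      · have : ∃ a b, σ (Sum.inl a) = π (Sum.inr b) := by
          by_contra! hcon
          refine hτ ?_
          rintro _ ⟨a, rfl⟩
          rcases hx : (π⁻¹ * σ) (Sum.inl a) with a' | b
          · exact ⟨a', rfl⟩
          · exact absurd ((Equiv.Perm.inv_eq_iff_eq.1 hx)) (hcon a b)
        obtain ⟨a, b, hab⟩ := this
        rw [coordForm_apply, Matrix.det_eq_zero_of_column_eq_zero b]
        · simp
        · intro i
          simp [he_apply, p, ← hab]
  choose N hN0 hN1 hN using hterm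
  have hsum : (∑ σ, N σ) * X = 0 := by
    rw [Finset.sum_mul, hw]
    exact Finset.sum_congr rfl fun σ _ => (hN σ).symm
  have hpos : 0 < ∑ σ, N σ :=
    Finset.sum_pos' (fun σ _ => hN0 σ) ⟨π, Finset.mem_univ _, by rw [hN1 π rfl]; exact one_pos⟩
  have hX0 := (mul_eq_zero.1 hsum).resolve_left hpos.ne'
  exact (mul_eq_zero.1 hX0).resolve_left (by simp)

end Nondegenerate

open MeasureTheory Filter

section Pullback

variable {E F : Type*} [NormedAddCommGroup E] [NormedSpace ℝ E]
  [NormedAddCommGroup F] [NormedSpace ℝ F] {k : ℕ}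

/-- The antisymmetrization of multilinear forms, normalized to be a left inverse of the inclusion
of alternating forms. -/
def antisymmCLM (k : ℕ) (E : Type*) [NormedAddCommGroup E] [NormedSpace ℝ E] :
    (ContinuousMultilinearMap ℝ (fun _ : Fin k => E) ℝ) →L[ℝ] (E [⋀^Fin k]→L[ℝ] ℝ) :=
  ((k.factorial : ℝ)⁻¹) • LinearMap.mkContinuous
    { toFun := fun a => ContinuousMultilinearMap.alternatization a
      map_add' := fun a b => map_add _ a b
      map_smul' := fun r a => by
        ext v
        simp [ContinuousMultilinearMap.alternatization_apply_apply, Finset.mul_sum,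
          Units.smul_def, mul_left_comm] } (k.factorial : ℝ) fun a => by
    refine ContinuousAlternatingMap.opNorm_le_bound _ (by positivity) fun v => ?_
    simp only [LinearMap.coe_mk, AddHom.coe_mk,
      ContinuousMultilinearMap.alternatization_apply_apply]
    refine (norm_sum_le _ _).trans ?_
    have : ∀ σ ∈ (Finset.univ : Finset (Equiv.Perm (Fin k))),
        ‖Equiv.Perm.sign σ • a (v ∘ σ)‖ ≤ ‖a‖ * ∏ i, ‖v i‖ := fun σ _ => by
      have h1 : ‖Equiv.Perm.sign σ • a (v ∘ σ)‖ = ‖a (v ∘ σ)‖ := by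
        rcases Int.units_eq_one_or (Equiv.Perm.sign σ) with h | h <;> simp [h]
      rw [h1]
      refine (a.le_opNorm _).trans_eq ?_
      congr 1
      exact Equiv.prod_comp σ fun i => ‖v i‖
    refine (Finset.sum_le_card_nsmul _ _ _ this).trans_eq ?_
    simp [Fintype.card_perm, mul_assoc]

theorem antisymmCLM_apply (a : E [⋀^Fin k]→L[ℝ] ℝ) :
    antisymmCLM k E a.toContinuousMultilinearMap = a := by
  ext v
  have h : ∀ σ : Equiv.Perm (Fin k),
      Equiv.Perm.sign σ • a.toContinuousMultilinearMap (v ∘ σ) = a v := fun σ => by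
    have h1 : a.toContinuousMultilinearMap (v ∘ σ) = Equiv.Perm.sign σ • a v :=
      a.toAlternatingMap.map_perm v σ
    rw [h1, smul_smul]
    simp
  simp only [antisymmCLM, FunLike.coe_smul, Pi.smul_apply,
    LinearMap.mkContinuous_apply, LinearMap.coe_mk, AddHom.coe_mk,
    ContinuousAlternatingMap.smul_apply, ContinuousMultilinearMap.alternatization_apply_apply, h]
  simp [Fintype.card_perm, Nat.factorial_ne_zero]

theorem contDiff_compContinuousLinearMap {r : WithTop ℕ∞} :
    ContDiff ℝ r fun p : (F [⋀^Fin k]→L[ℝ] ℝ) × (E →L[ℝ] F) =>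
      p.1.compContinuousLinearMap p.2 := by
  have h : ContDiff ℝ r fun p : (F [⋀^Fin k]→L[ℝ] ℝ) × (E →L[ℝ] F) =>
      antisymmCLM k E
        ((ContinuousMultilinearMap.compContinuousLinearMapContinuousMultilinear ℝ
          (fun _ : Fin k => E) (fun _ => F) ℝ (fun _ => p.2))
            (ContinuousAlternatingMap.toContinuousMultilinearMapCLM ℝ p.1)) := by
    refine (antisymmCLM k E).contDiff.comp (ContDiff.clm_apply ?_ ?_)
    · exact (ContinuousMultilinearMap.contDiff _).comp (contDiff_pi.2 fun _ => contDiff_snd)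
    · exact (ContinuousLinearMap.contDiff _).comp contDiff_fst
  convert h using 2 with p
  exact (antisymmCLM_apply (p.1.compContinuousLinearMap p.2)).symm

theorem continuous_compContinuousLinearMap :
    Continuous fun p : (F [⋀^Fin k]→L[ℝ] ℝ) × (E →L[ℝ] F) =>
      p.1.compContinuousLinearMap p.2 :=
  (contDiff_compContinuousLinearMap (r := 0)).continuous

/-- The exterior product of covectors with `k`-forms as a continuous bilinear map. -/
def covecWedgeCLM (k : ℕ) (E : Type*) [NormedAddCommGroup E] [NormedSpace ℝ E] :
    (E →L[ℝ] ℝ) →L[ℝ] (E [⋀^Fin k]→L[ℝ] ℝ) →L[ℝ] E [⋀^Fin (k + 1)]→L[ℝ] ℝ :=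
  ((ContinuousLinearMap.compL ℝ _ _ _
    (ContinuousAlternatingMap.alternatizeUncurryFinCLM ℝ E ℝ)).comp
      (ContinuousLinearMap.smulRightL ℝ E (E [⋀^Fin k]→L[ℝ] ℝ)))

theorem norm_covecWedge_le (ℓ : E →L[ℝ] ℝ) (a : E [⋀^Fin k]→L[ℝ] ℝ) :
    ‖covecWedge ℓ a‖ ≤ (k + 1) * (‖ℓ‖ * ‖a‖) := by
  rw [← ContinuousLinearMap.norm_smulRight_apply]
  exact ContinuousAlternatingMap.norm_alternatizeUncurryFin_le _

theorem continuous_covecWedge :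
    Continuous fun p : (E →L[ℝ] ℝ) × (E [⋀^Fin k]→L[ℝ] ℝ) => covecWedge p.1 p.2 :=
  ((covecWedgeCLM k E).continuous.comp continuous_fst).clm_apply continuous_snd

theorem covecWedge_sub (ℓ : E →L[ℝ] ℝ) (a b : E [⋀^Fin k]→L[ℝ] ℝ) :
    covecWedge ℓ (a - b) = covecWedge ℓ a - covecWedge ℓ b :=
  map_sub (covecWedgeCLM k E ℓ) a b

theorem fderiv_eq_zero_of_notMem_tsupport {χ : E → ℝ} {x : E} (hx : x ∉ tsupport χ) :
    fderiv ℝ χ x = 0 := by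
  by_contra hne
  exact hx (tsupport_fderiv_subset ℝ (subset_tsupport _ hne))

theorem covecWedge_zero_left (a : E [⋀^Fin k]→L[ℝ] ℝ) : covecWedge (0 : E →L[ℝ] ℝ) a = 0 :=
  (covecWedgeCLM k E).map_zero₂ a

theorem extDeriv_smul_fun {χ : E → ℝ} {η : E → E [⋀^Fin k]→L[ℝ] ℝ} {x : E}
    (hχ : DifferentiableAt ℝ χ x) (hη : DifferentiableAt ℝ η x) :
    extDeriv (fun y => χ y • η y) x = covecWedge (fderiv ℝ χ x) (η x) + χ x • extDeriv η x := by
  rw [extDeriv, fderiv_fun_smul hχ hη, ContinuousAlternatingMap.alternatizeUncurryFin_add,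
    ContinuousAlternatingMap.alternatizeUncurryFin_smul]
  exact add_comm _ _

theorem continuous_extDeriv {η : E → E [⋀^Fin k]→L[ℝ] ℝ} (hη : ContDiff ℝ 1 η) :
    Continuous (extDeriv η) :=
  (ContinuousAlternatingMap.alternatizeUncurryFinCLM ℝ E ℝ).continuous.comp
    (hη.continuous_fderiv one_ne_zero)

end Pullback

section Stokes

variable {E : Type*} [NormedAddCommGroup E] [NormedSpace ℝ E] [FiniteDimensional ℝ E]
  [MeasurableSpace E] [BorelSpace E] {ν : Measure E} [ν.IsAddHaarMeasure] {k : ℕ}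

theorem integral_fderiv_eq_zero {W : Type*} [NormedAddCommGroup W] [NormedSpace ℝ W]
    [CompleteSpace W] {g : E → W} (hg : ContDiff ℝ 1 g) (hc : HasCompactSupport g) :
    ∫ x, fderiv ℝ g x ∂ν = 0 := by
  have hint : Integrable (fderiv ℝ g) ν :=
    (hg.continuous_fderiv one_ne_zero).integrable_of_hasCompactSupport (hc.fderiv ℝ)
  ext v
  rw [ContinuousLinearMap.integral_apply hint]
  have h := integral_smul_fderiv_eq_neg_fderiv_smul_of_integrable (μ := ν) (𝕜 := ℝ)
    (f := fun _ => (1 : ℝ)) (g := g) (v := v) (by simp)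
    (by simpa using hint.apply_continuousLinearMap v)
    (by simpa using hg.continuous.integrable_of_hasCompactSupport hc)
    (fun x _ => differentiableAt_const _) (fun x _ => hg.differentiable one_ne_zero x)
  simpa using h

theorem integral_covecWedge_add_smul_extDeriv {χ : E → ℝ} {η : E → E [⋀^Fin k]→L[ℝ] ℝ}
    (hχ : ContDiff ℝ 1 χ) (hc : HasCompactSupport χ) (hη : ContDiff ℝ 1 η) :
    ∫ x, (covecWedge (fderiv ℝ χ x) (η x) + χ x • extDeriv η x) ∂ν = 0 := by
  have hs : ContDiff ℝ 1 fun y => χ y • η y := hχ.smul hη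
  have hsc : HasCompactSupport fun y => χ y • η y := hc.smul_right
  have h : ∀ x, covecWedge (fderiv ℝ χ x) (η x) + χ x • extDeriv η x =
      ContinuousAlternatingMap.alternatizeUncurryFinCLM ℝ E ℝ (fderiv ℝ (fun y => χ y • η y) x) :=
    fun x => (extDeriv_smul_fun (hχ.differentiable one_ne_zero x)
      (hη.differentiable one_ne_zero x)).symm
  simp only [h]
  rw [ContinuousLinearMap.integral_comp_comm _
    ((hs.continuous_fderiv one_ne_zero).integrable_of_hasCompactSupport (hsc.fderiv ℝ)),
    integral_fderiv_eq_zero hs hsc, map_zero]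

end Stokes

section Mollify

variable {E F W : Type*} [NormedAddCommGroup E] [NormedSpace ℝ E] [FiniteDimensional ℝ E]
  [MeasurableSpace E] [BorelSpace E] {ν : Measure E} [ν.IsAddHaarMeasure]
  [NormedAddCommGroup F] [NormedSpace ℝ F] [FiniteDimensional ℝ F]
  [NormedAddCommGroup W] [NormedSpace ℝ W]

/-- A compactly supported `C^1` map is a limit of smooth maps, strongly enough to pass to the limit
in integrals of continuous functions of the map and its derivative. -/
theorem exists_seq_contDiff_tendsto_integral {f : E → F} (hf : ContDiff ℝ 1 f)
    (hc : HasCompactSupport f) :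
    ∃ g : ℕ → E → F, (∀ i, ContDiff ℝ (⊤ : ℕ∞) (g i)) ∧
      ∀ (G : E × F × (E →L[ℝ] F) → W) (K : Set E), Continuous G → IsCompact K →
        (∀ x ∉ K, ∀ p, G (x, p) = 0) →
        Tendsto (fun i => ∫ x, G (x, g i x, fderiv ℝ (g i) x) ∂ν) atTop
          (𝓝 (∫ x, G (x, f x, fderiv ℝ f x) ∂ν)) := by
  let φ : ℕ → ContDiffBump (0 : E) := fun i =>
    ⟨1 / ((i : ℝ) + 1), 2 / ((i : ℝ) + 1), by positivity, by gcongr; norm_num⟩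
  have hφ : Tendsto (fun i => (φ i).rOut) atTop (𝓝 0) := by
    have := (tendsto_one_div_add_atTop_nhds_zero_nat (𝕜 := ℝ)).const_mul 2
    simpa [φ, div_eq_mul_inv] using this
  let g : ℕ → E → F := fun i => convolution ((φ i).normed ν) f (ContinuousLinearMap.lsmul ℝ ℝ) ν
  have hdf : Continuous (fderiv ℝ f) := hf.continuous_fderiv one_ne_zero
  have hgd : ∀ i x, fderiv ℝ (g i) x = convolution ((φ i).normed ν) (fderiv ℝ f)
      (ContinuousLinearMap.lsmul ℝ ℝ) ν x := fun i x => by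
    rw [(hc.hasFDerivAt_convolution_right (ContinuousLinearMap.lsmul ℝ ℝ)
      ((φ i).continuous_normed.locallyIntegrable (μ := ν)) hf x).fderiv]
    rfl
  obtain ⟨C, hC⟩ := hc.exists_bound_of_continuous hf.continuous
  obtain ⟨C', hC'⟩ := (hc.fderiv ℝ).exists_bound_of_continuous hdf
  have hgC : ∀ i x, g i x ∈ Metric.closedBall (0 : F) (2 * C + C) := fun i x => by
    have h := (φ i).dist_normed_convolution_le (μ := ν) (x₀ := x) (ε := 2 * C)
      hf.continuous.aestronglyMeasurable fun y _ => by
        refine (dist_le_norm_add_norm _ _).trans ?_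
        linarith [hC x, hC y]
    rw [mem_closedBall_zero_iff]
    have h2 := norm_le_norm_add_norm_sub' (g i x) (f x)
    rw [← dist_eq_norm] at h2
    linarith [hC x]
  have hgC' : ∀ i x, fderiv ℝ (g i) x ∈ Metric.closedBall (0 : E →L[ℝ] F) (2 * C' + C') :=
      fun i x => by
    have h := (φ i).dist_normed_convolution_le (μ := ν) (x₀ := x) (ε := 2 * C')
      hdf.aestronglyMeasurable fun y _ => by
        refine (dist_le_norm_add_norm _ _).trans ?_
        linarith [hC' x, hC' y]
    rw [mem_closedBall_zero_iff, hgd]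
    have h2 := norm_le_norm_add_norm_sub' (convolution ((φ i).normed ν) (fderiv ℝ f)
      (ContinuousLinearMap.lsmul ℝ ℝ) ν x) (fderiv ℝ f x)
    rw [← dist_eq_norm] at h2
    linarith [hC' x]
  have hgs : ∀ i, ContDiff ℝ (⊤ : ℕ∞) (g i) := fun i =>
    (φ i).hasCompactSupport_normed.contDiff_convolution_left _ (φ i).contDiff_normed
      (hf.continuous.locallyIntegrable)
  refine ⟨g, hgs, fun G K hG hK hGK => ?_⟩
  have hcomp : IsCompact (K ×ˢ (Metric.closedBall (0 : F) (2 * C + C) ×ˢ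
      Metric.closedBall (0 : E →L[ℝ] F) (2 * C' + C'))) :=
    hK.prod ((isCompact_closedBall _ _).prod (isCompact_closedBall _ _))
  obtain ⟨D, hD⟩ := hcomp.exists_bound_of_continuousOn hG.continuousOn
  refine tendsto_integral_of_dominated_convergence (K.indicator fun _ => D) (fun i => ?_) ?_
    (fun i => ?_) ?_
  · refine Continuous.aestronglyMeasurable (hG.comp ?_)
    exact continuous_id.prodMk ((hgs i).continuous.prodMk ((hgs i).continuous_fderiv (by simp)))
  · exact (integrable_indicator_iff hK.measurableSet).2
      (integrableOn_const hK.measure_lt_top.ne)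
  · refine Eventually.of_forall fun x => ?_
    by_cases hx : x ∈ K
    · rw [Set.indicator_of_mem hx]
      exact hD _ ⟨hx, hgC i x, hgC' i x⟩
    · rw [Set.indicator_of_notMem hx, hGK x hx, norm_zero]
  · refine Eventually.of_forall fun x => (hG.tendsto _).comp ?_
    refine tendsto_const_nhds.prodMk_nhds (Tendsto.prodMk_nhds ?_ ?_)
    · exact ContDiffBump.convolution_tendsto_right_of_continuous hφ hf.continuous x
    · simp only [hgd]
      exact ContDiffBump.convolution_tendsto_right_of_continuous hφ hdf x

/-- The pullback of a `C^1` form under a `C^1` map has the pullback of the exterior derivative as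
its distributional exterior derivative. -/
theorem integral_covecWedge_pullback {k : ℕ} {f : E → F} (hf : ContDiff ℝ 1 f)
    (hc : HasCompactSupport f) {ω : F → F [⋀^Fin k]→L[ℝ] ℝ} (hω : ContDiff ℝ 1 ω)
    {χ : E → ℝ} (hχ : ContDiff ℝ 1 χ) (hχc : HasCompactSupport χ) :
    ∫ x, (covecWedge (fderiv ℝ χ x) ((ω (f x)).compContinuousLinearMap (fderiv ℝ f x)) +
      χ x • (extDeriv ω (f x)).compContinuousLinearMap (fderiv ℝ f x)) ∂ν = 0 := by
  obtain ⟨g, hg, hlim⟩ := exists_seq_contDiff_tendsto_integral (ν := ν)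
    (W := E [⋀^Fin (k + 1)]→L[ℝ] ℝ) hf hc
  let G : E × F × (E →L[ℝ] F) → E [⋀^Fin (k + 1)]→L[ℝ] ℝ := fun p =>
    covecWedge (fderiv ℝ χ p.1) ((ω p.2.1).compContinuousLinearMap p.2.2) +
      χ p.1 • (extDeriv ω p.2.1).compContinuousLinearMap p.2.2
  have hG : Continuous G := by
    have hdχ := hχ.continuous_fderiv one_ne_zero
    have hdω := continuous_extDeriv hω
    have hω' := hω.continuous
    refine (continuous_covecWedge.comp ((hdχ.comp continuous_fst).prodMk
      (continuous_compContinuousLinearMap.comp (f := fun p : E × F × (E →L[ℝ] F) =>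
        (ω p.2.1, p.2.2)) (by fun_prop)))).add ?_
    exact (hχ.continuous.comp continuous_fst).smul
      (continuous_compContinuousLinearMap.comp (f := fun p : E × F × (E →L[ℝ] F) =>
        (extDeriv ω p.2.1, p.2.2)) (by fun_prop))
  have h := hlim G (tsupport χ) hG hχc fun x hx p => by
    have h1 : χ x = 0 := image_eq_zero_of_notMem_tsupport hx
    simp only [G, h1, fderiv_eq_zero_of_notMem_tsupport hx, covecWedge_zero_left, zero_smul,
      add_zero]
  refine tendsto_nhds_unique h ?_
  refine tendsto_const_nhds.congr fun i => ?_
  have hη : ContDiff ℝ 1 fun x => (ω (g i x)).compContinuousLinearMap (fderiv ℝ (g i) x) :=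
    contDiff_compContinuousLinearMap.comp ((hω.comp ((hg i).of_le (by simp))).prodMk
      ((hg i).fderiv_right (by norm_cast)))
  rw [← integral_covecWedge_add_smul_extDeriv (ν := ν) hχ hχc hη]
  refine integral_congr_ae (Eventually.of_forall fun x => ?_)
  simp only [G]
  rw [extDeriv_pullback (hω.differentiable one_ne_zero _) ((hg i).contDiffAt (x := x))
    (by simp only [minSmoothness_of_isRCLikeNormedField]
        exact WithTop.coe_le_coe.2 (le_top : (2 : ℕ∞) ≤ ⊤))]

end Mollify

theorem continuous_of_continuousOn_of_eq_zero {X W : Type*} [TopologicalSpace X]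
    [TopologicalSpace W] [Zero W] {g : X → W} {V K : Set X} (hg : ContinuousOn g V)
    (hV : IsOpen V) (hK : IsClosed K) (hKV : K ⊆ V) (h0 : ∀ x ∉ K, g x = 0) : Continuous g :=
  hg.continuous_of_tsupport_subset hV
    ((closure_minimal (fun x (hx : g x ≠ 0) => by_contra fun h => hx (h0 x h)) hK).trans hKV)

theorem integrable_smul_form {E : Type*} [NormedAddCommGroup E] [NormedSpace ℝ E]
    [MeasurableSpace E] [BorelSpace E] {ν : Measure E} [IsFiniteMeasureOnCompacts ν] {k : ℕ}
    {V : Set E} (hV : IsOpen V) {χ : E → ℝ} (hχ : Continuous χ)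
    (hχc : HasCompactSupport χ) (hsub : tsupport χ ⊆ V) {θ : E → E [⋀^Fin k]→L[ℝ] ℝ}
    (hθ : ContinuousOn θ V) : Integrable (fun x => χ x • θ x) ν := by
  have hs : ∀ x ∉ tsupport χ, χ x • θ x = 0 := fun x hx => by
    rw [image_eq_zero_of_notMem_tsupport hx, zero_smul]
  refine Continuous.integrable_of_hasCompactSupport ?_ (HasCompactSupport.intro hχc hs)
  exact continuous_of_continuousOn_of_eq_zero (hχ.continuousOn.smul hθ) hV
    (isClosed_tsupport χ) hsub hs

theorem integrable_covecWedge {E : Type*} [NormedAddCommGroup E] [NormedSpace ℝ E]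
    [MeasurableSpace E] [BorelSpace E] {ν : Measure E} [IsFiniteMeasureOnCompacts ν] {k : ℕ}
    {V : Set E} (hV : IsOpen V) {χ : E → ℝ} (hχ : ContDiff ℝ 1 χ)
    (hχc : HasCompactSupport χ) (hsub : tsupport χ ⊆ V) {η : E → E [⋀^Fin k]→L[ℝ] ℝ}
    (hη : ContinuousOn η V) : Integrable (fun x => covecWedge (fderiv ℝ χ x) (η x)) ν := by
  have hs : ∀ x ∉ tsupport χ, covecWedge (fderiv ℝ χ x) (η x) = 0 := fun x hx => by
    rw [fderiv_eq_zero_of_notMem_tsupport hx, covecWedge_zero_left]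
  refine Continuous.integrable_of_hasCompactSupport ?_ (HasCompactSupport.intro hχc hs)
  refine continuous_of_continuousOn_of_eq_zero ?_ hV (isClosed_tsupport χ) hsub hs
  exact continuous_covecWedge.comp_continuousOn
    ((hχ.continuous_fderiv one_ne_zero).continuousOn.prodMk hη)

section Density

variable {E : Type*} [NormedAddCommGroup E] [NormedSpace ℝ E] [FiniteDimensional ℝ E]
  [MeasurableSpace E] [BorelSpace E] {ν : Measure E} [ν.IsAddHaarMeasure] {k : ℕ}

/-- Rescaled smooth bump functions concentrating at a point. -/
theorem exists_rescaled_bump (ν : Measure E) [ν.IsAddHaarMeasure] (x₀ : E) :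
    ∃ (C I : ℝ), 0 ≤ C ∧ 0 < I ∧ ∀ r : ℝ, 0 < r → ∃ χ : E → ℝ, ContDiff ℝ (⊤ : ℕ∞) χ ∧
      tsupport χ ⊆ Metric.closedBall x₀ (2 * r) ∧ (∀ x, 0 ≤ χ x) ∧
      (∀ x, ‖fderiv ℝ χ x‖ ≤ C / r) ∧ ∫ x, χ x ∂ν = I * r ^ Module.finrank ℝ E := by
  let b : ContDiffBump (0 : E) := ⟨1, 2, one_pos, by norm_num⟩
  have hb : ContDiff ℝ (⊤ : ℕ∞) b := b.contDiff
  obtain ⟨C, hC⟩ := (b.hasCompactSupport.fderiv ℝ).exists_bound_of_continuous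
    (hb.continuous_fderiv (by simp))
  refine ⟨C, ∫ x, b x ∂ν, (norm_nonneg _).trans (hC 0), b.integral_pos, fun r hr => ?_⟩
  have haff : ∀ x, HasFDerivAt (fun x : E => r⁻¹ • (x - x₀)) (r⁻¹ • ContinuousLinearMap.id ℝ E) x :=
    fun x => ((hasFDerivAt_id x).sub_const x₀).const_smul r⁻¹
  refine ⟨fun x => b (r⁻¹ • (x - x₀)), ?_, ?_, fun x => b.nonneg, fun x => ?_, ?_⟩
  · exact hb.comp ((contDiff_id.sub contDiff_const).const_smul r⁻¹)
  · refine closure_minimal (fun x hx => ?_) Metric.isClosed_closedBall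
    have h1 : r⁻¹ • (x - x₀) ∈ Function.support b := hx
    rw [b.support_eq, mem_ball_zero_iff, norm_smul, norm_inv, Real.norm_of_nonneg hr.le,
      inv_mul_lt_iff₀ hr] at h1
    rw [Metric.mem_closedBall, dist_eq_norm]
    exact (h1.trans_eq (mul_comm _ _)).le
  · have h := (hb.differentiable (by simp) (r⁻¹ • (x - x₀))).hasFDerivAt.comp x (haff x)
    rw [show (fun x => b (r⁻¹ • (x - x₀))) = b ∘ fun x => r⁻¹ • (x - x₀) from rfl, h.fderiv,
      ContinuousLinearMap.comp_smul, ContinuousLinearMap.comp_id, norm_smul, norm_inv,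
      Real.norm_of_nonneg hr.le, div_eq_inv_mul]
    gcongr
    exact hC _
  · rw [integral_sub_right_eq_self (fun x => b (r⁻¹ • x)) x₀,
      Measure.integral_comp_inv_smul_of_nonneg ν b hr.le, smul_eq_mul, mul_comm]

theorem eq_zero_of_weak_of_density {V : Set E} (hV : IsOpen V) {x₀ : E} (hx₀ : x₀ ∈ V)
    {η : E → E [⋀^Fin k]→L[ℝ] ℝ} {θ : E → E [⋀^Fin (k + 1)]→L[ℝ] ℝ}
    (hη : ContinuousOn η V) (hθ : ContinuousOn θ V)
    (hweak : ∀ χ : E → ℝ, ContDiff ℝ (⊤ : ℕ∞) χ → HasCompactSupport χ → tsupport χ ⊆ V →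
      ∫ x, (covecWedge (fderiv ℝ χ x) (η x) + χ x • θ x) ∂ν = 0)
    (hden : (fun r : ℝ => (ν (Metric.ball x₀ r \ {x | η x = 0})).toReal) =o[𝓝[>] 0]
      fun r : ℝ => r ^ (Module.finrank ℝ E + 1)) : θ x₀ = 0 := by
  obtain ⟨C, I, hC, hI, hbump⟩ := exists_rescaled_bump ν x₀
  obtain ⟨R, hR, hRV⟩ := Metric.nhds_basis_closedBall.mem_iff.1 (hV.mem_nhds hx₀)
  obtain ⟨D, hD⟩ := (isCompact_closedBall x₀ R).exists_bound_of_continuousOn (hη.mono hRV)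
  have hD0 : 0 ≤ D := (norm_nonneg _).trans (hD x₀ (Metric.mem_closedBall_self hR.le))
  set n := Module.finrank ℝ E
  set B := ((k : ℝ) + 1) * (C * D) with hB
  have hB0 : 0 ≤ B := by positivity
  rw [← norm_le_zero_iff]
  refine le_of_forall_pos_le_add fun ε hε => ?_
  rw [zero_add]
  obtain ⟨δ, hδ, hδB⟩ : ∃ δ : ℝ, 0 < δ ∧ B * δ * 3 ^ (n + 1) ≤ ε / 2 * I := by
    refine ⟨ε / 2 * I / ((B + 1) * 3 ^ (n + 1)), by positivity, ?_⟩
    rw [mul_div_assoc', div_mul_eq_mul_div, div_le_iff₀ (by positivity)]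
    have : 0 ≤ ε / 2 * I * 3 ^ (n + 1) := by positivity
    nlinarith
  have hθ₀ : ∀ᶠ x in 𝓝 x₀, dist (θ x) (θ x₀) ≤ ε / 2 :=
    (hθ.continuousAt (hV.mem_nhds hx₀)).eventually (Metric.closedBall_mem_nhds _ (by positivity))
  obtain ⟨R', hR', hθR'⟩ := Metric.eventually_nhds_iff.1 hθ₀
  have hmul : Tendsto (fun r : ℝ => 3 * r) (𝓝[>] 0) (𝓝[>] 0) := by
    refine tendsto_nhdsWithin_iff.2 ⟨?_, ?_⟩
    · have : Tendsto (fun r : ℝ => 3 * r) (𝓝 0) (𝓝 (3 * 0)) := tendsto_id.const_mul 3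
      rw [mul_zero] at this
      exact this.mono_left nhdsWithin_le_nhds
    · filter_upwards [self_mem_nhdsWithin] with r hr
      simpa using hr
  have hsmall : ∀ᶠ r : ℝ in 𝓝[>] 0, 0 < r ∧ 3 * r < R ∧ 3 * r < R' ∧
      (ν (Metric.ball x₀ (3 * r) \ {x | η x = 0})).toReal ≤ δ * (3 * r) ^ (n + 1) := by
    have h1 := hmul.eventually (hden.bound hδ)
    have h2 : ∀ᶠ r : ℝ in 𝓝[>] 0, 3 * r < min R R' :=
      hmul.eventually (mem_nhdsWithin_of_mem_nhds (Iio_mem_nhds (lt_min hR hR')))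
    filter_upwards [h1, h2, self_mem_nhdsWithin] with r h1 h2 h3
    have h3' : (0 : ℝ) < r := h3
    refine ⟨h3, h2.trans_le (min_le_left _ _), h2.trans_le (min_le_right _ _), ?_⟩
    rwa [Real.norm_of_nonneg ENNReal.toReal_nonneg, Real.norm_of_nonneg (by positivity)] at h1
  obtain ⟨r, hr, hrR, hrR', hrδ⟩ := hsmall.exists
  obtain ⟨χ, hχ, hχs, hχ0, hχd, hχI⟩ := hbump r hr
  have hχc : HasCompactSupport χ :=
    HasCompactSupport.of_support_subset_isCompact (isCompact_closedBall x₀ (2 * r))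
      ((subset_tsupport _).trans hχs)
  have hsub : tsupport χ ⊆ Metric.ball x₀ (3 * r) :=
    hχs.trans (Metric.closedBall_subset_ball (by linarith))
  have hsubR : Metric.ball x₀ (3 * r) ⊆ Metric.closedBall x₀ R :=
    (Metric.ball_subset_closedBall).trans (Metric.closedBall_subset_closedBall hrR.le)
  have hsubV : tsupport χ ⊆ V := hsub.trans (hsubR.trans hRV)
  have hχz : ∀ x ∉ tsupport χ, χ x = 0 := fun x hx => image_eq_zero_of_notMem_tsupport hx
  have hint1 : Integrable (fun x => covecWedge (fderiv ℝ χ x) (η x)) ν :=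
    integrable_covecWedge hV (hχ.of_le (by simp)) hχc hsubV hη
  have hχint : Integrable χ ν := hχ.continuous.integrable_of_hasCompactSupport hχc
  have hint2 : Integrable (fun x => χ x • θ x) ν :=
    integrable_smul_form hV hχ.continuous hχc hsubV hθ
  have h0 := hweak χ hχ hχc hsubV
  rw [integral_add hint1 hint2] at h0
  have hfin : ν (Metric.ball x₀ (3 * r) \ {x | η x = 0}) < ⊤ :=
    (measure_mono Set.sdiff_subset).trans_lt measure_ball_lt_top
  have hest1 : ‖∫ x, covecWedge (fderiv ℝ χ x) (η x) ∂ν‖ ≤ ε / 2 * I * r ^ n := by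
    rw [← setIntegral_eq_integral_of_forall_compl_eq_zero
      (s := Metric.ball x₀ (3 * r) \ {x | η x = 0})]
    · refine (norm_setIntegral_le_of_norm_le_const (C := B / r) hfin fun x hx => ?_).trans ?_
      · refine (norm_covecWedge_le _ _).trans ?_
        rw [hB, mul_div_assoc, ← div_mul_eq_mul_div]
        gcongr
        · exact hχd x
        · exact hD x (hsubR hx.1)
      · calc B / r * ν.real (Metric.ball x₀ (3 * r) \ {x | η x = 0})
            ≤ B / r * (δ * (3 * r) ^ (n + 1)) := by gcongr; exact hrδ
          _ = B * δ * 3 ^ (n + 1) * r ^ n := by rw [mul_pow]; field_simp; ring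
          _ ≤ ε / 2 * I * r ^ n := by gcongr
    · intro x hx
      by_cases hx1 : x ∈ tsupport χ
      · have : η x = 0 := by
          by_contra hne
          exact hx ⟨hsub hx1, hne⟩
        rw [this]
        exact map_zero (covecWedgeCLM k E (fderiv ℝ χ x))
      · rw [fderiv_eq_zero_of_notMem_tsupport hx1, covecWedge_zero_left]
  have hest2 : ‖∫ x, χ x • (θ x - θ x₀) ∂ν‖ ≤ ε / 2 * (I * r ^ n) := by
    rw [← hχI, ← integral_const_mul]
    refine norm_integral_le_of_norm_le (hχint.const_mul _) (Eventually.of_forall fun x => ?_)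
    rw [norm_smul, Real.norm_of_nonneg (hχ0 x), mul_comm]
    by_cases hx : x ∈ tsupport χ
    · have h1 := hθR' ((Metric.mem_ball.1 (hsub hx)).trans hrR')
      rw [dist_eq_norm] at h1
      exact mul_le_mul_of_nonneg_right h1 (hχ0 x)
    · simp [hχz x hx]
  have hsplit : ∫ x, χ x • θ x ∂ν = ∫ x, χ x • (θ x - θ x₀) ∂ν + (I * r ^ n) • θ x₀ := by
    rw [← hχI, ← integral_smul_const (μ := ν) χ (θ x₀), ← integral_add]
    · simp [smul_sub]
    · simp only [smul_sub]
      exact hint2.sub (hχint.smul_const _)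
    · exact hχint.smul_const _
  rw [hsplit] at h0
  have hfinal : ‖(I * r ^ n) • θ x₀‖ ≤ ε * (I * r ^ n) := by
    have : (I * r ^ n) • θ x₀ = -(∫ x, covecWedge (fderiv ℝ χ x) (η x) ∂ν) -
        ∫ x, χ x • (θ x - θ x₀) ∂ν := by
      rw [← sub_eq_zero, ← h0]; abel
    rw [this]
    refine (norm_sub_le _ _).trans ?_
    rw [norm_neg]
    linarith
  rw [norm_smul, Real.norm_of_nonneg (by positivity), mul_comm] at hfinal
  exact le_of_mul_le_mul_right hfinal (by positivity)

end Density

section Transfer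

/-- A map that is `C^1` near a point distorts small balls and volumes by bounded factors. -/
theorem isLittleO_density_transfer {n : ℕ}
    {T S : EuclideanSpace ℝ (Fin n) → EuclideanSpace ℝ (Fin n)}
    {x₀ y₀ : EuclideanSpace ℝ (Fin n)} {A B : Set (EuclideanSpace ℝ (Fin n))}
    (hT : ContDiffAt ℝ 1 T x₀) (hS : ContDiffAt ℝ 1 S y₀) (hTx : T x₀ = y₀)
    (hST : ∀ᶠ x in 𝓝 x₀, S (T x) = x) (hAB : ∀ᶠ x in 𝓝 x₀, T x ∈ B → x ∈ A)
    (hB : (fun r : ℝ => (volume (Metric.ball y₀ r \ B)).toReal) =o[𝓝[>] 0]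
      fun r : ℝ => r ^ (n + 1)) :
    (fun r : ℝ => (volume (Metric.ball x₀ r \ A)).toReal) =o[𝓝[>] 0]
      fun r : ℝ => r ^ (n + 1) := by
  obtain ⟨K, t, ht, hK⟩ := hT.exists_lipschitzOnWith
  have hS' := hS.hasStrictFDerivAt one_ne_zero
  set S' := fderiv ℝ S y₀
  obtain ⟨m, hm⟩ := exists_gt ‖S'.det‖₊
  have hm' : ENNReal.ofReal |S'.det| < m := by
    rw [← Real.norm_eq_abs, ofReal_norm]
    exact ENNReal.coe_lt_coe.2 hm
  obtain ⟨δ, hδ, hδ0⟩ := ((addHaar_image_le_mul_of_det_lt volume S' hm').and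
    self_mem_nhdsWithin).exists
  obtain ⟨s, hs, hSs⟩ := hS'.approximates_deriv_on_nhds (c := δ) (Or.inr hδ0)
  have hTc : ContinuousAt T x₀ := hT.continuousAt
  have hev : ∀ᶠ x in 𝓝 x₀, x ∈ t ∧ T x ∈ s ∧ S (T x) = x ∧ (T x ∈ B → x ∈ A) :=
    (eventually_mem_set.2 ht).and
      ((hTc.eventually (by rw [hTx]; exact eventually_mem_set.2 hs)).and (hST.and hAB))
  obtain ⟨R, hR, hball⟩ := Metric.eventually_nhds_iff.1 hev
  have hKp : (0 : ℝ) < K + 1 := by positivity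
  have hmul : Tendsto (fun r : ℝ => (K + 1) * r) (𝓝[>] 0) (𝓝[>] 0) := by
    refine tendsto_nhdsWithin_iff.2 ⟨?_, ?_⟩
    · have : Tendsto (fun r : ℝ => ((K : ℝ) + 1) * r) (𝓝 0) (𝓝 ((K + 1) * 0)) :=
        tendsto_id.const_mul _
      rw [mul_zero] at this
      exact this.mono_left nhdsWithin_le_nhds
    · filter_upwards [self_mem_nhdsWithin] with r hr
      exact mul_pos hKp hr
  have hcomp := hB.comp_tendsto hmul
  refine Asymptotics.IsBigO.trans_isLittleO
    (g := fun r : ℝ => (volume (Metric.ball y₀ ((K + 1) * r) \ B)).toReal) ?_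
    (hcomp.trans_isBigO ?_)
  · refine Asymptotics.IsBigO.of_bound m ?_
    filter_upwards [self_mem_nhdsWithin, mem_nhdsWithin_of_mem_nhds (Iio_mem_nhds hR)]
      with r hr hrR
    have hr0 : (0 : ℝ) < r := hr
    rw [Real.norm_of_nonneg ENNReal.toReal_nonneg, Real.norm_of_nonneg ENNReal.toReal_nonneg]
    have hsub : Metric.ball x₀ r \ A ⊆ S '' ((Metric.ball y₀ ((K + 1) * r) \ B) ∩ s) := by
      rintro x ⟨hx, hxA⟩
      obtain ⟨hxt, hxs, hxS, hxB⟩ := hball (lt_trans (Metric.mem_ball.1 hx) hrR)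
      refine ⟨T x, ⟨⟨?_, fun h => hxA (hxB h)⟩, hxs⟩, hxS⟩
      have hd := hK.dist_le_mul x hxt x₀ (mem_of_mem_nhds ht)
      rw [hTx] at hd
      rw [Metric.mem_ball]
      have : dist x x₀ < r := hx
      have hK0 : (0 : ℝ) ≤ K := K.2
      nlinarith
    have hle : volume (Metric.ball x₀ r \ A) ≤ m * volume (Metric.ball y₀ ((K + 1) * r) \ B) :=
      (measure_mono hsub).trans ((hδ _ S (hSs.mono_set Set.inter_subset_right)).trans
        (by gcongr; exact Set.inter_subset_left))
    have hfin : volume (Metric.ball y₀ ((K + 1) * r) \ B) ≠ ⊤ :=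
      ((measure_mono Set.sdiff_subset).trans_lt measure_ball_lt_top).ne
    have := ENNReal.toReal_mono (ENNReal.mul_ne_top ENNReal.coe_ne_top hfin) hle
    simpa using this
  · refine Asymptotics.IsBigO.of_bound (((K : ℝ) + 1) ^ (n + 1)) (Eventually.of_forall fun r => ?_)
    simp only [Function.comp_apply]
    rw [mul_pow, norm_mul, Real.norm_of_nonneg (by positivity)]

end Transfer

theorem eventually_mem_overlap {M H : Type*} [TopologicalSpace M] [TopologicalSpace H]
    {e e' : OpenPartialHomeomorph M H} {y : H}
    (hy : y ∈ e'.target) (hy' : e'.symm y ∈ e.source) :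
    ∀ᶠ z in 𝓝 y, z ∈ e'.target ∧ e'.symm z ∈ e.source :=
  (e'.open_target.eventually_mem hy).and
    ((e'.continuousAt_symm hy).eventually (e.open_source.mem_nhds hy'))

section Charts

variable {n : ℕ} {M : Type*} [TopologicalSpace M] [ChartedSpace (EuclideanSpace ℝ (Fin n)) M]
variable {n' : ℕ} {N : Type*} [TopologicalSpace N] [ChartedSpace (EuclideanSpace ℝ (Fin n')) N]
variable {k : ℕ}

theorem compContinuousLinearMap_congr {X : Type*} [AddCommGroup X] [Module ℝ X]
    [TopologicalSpace X] (α : Form n M k) {p q : M} (hpq : p = q)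
    (A : X →L[ℝ] TangentSpace (𝓡 n) p) (B : X →L[ℝ] TangentSpace (𝓡 n) q)
    (hAB : ∀ v, (A v : EuclideanSpace ℝ (Fin n)) = B v) :
    (α p).compContinuousLinearMap A = (α q).compContinuousLinearMap B := by
  subst hpq
  obtain rfl : A = B := ContinuousLinearMap.ext hAB
  rfl

/-- The chain rule for pullbacks along a map that factors through a map of vector spaces. -/
theorem pullback_eq_of_eventuallyEq_comp (α : Form n M k)
    {g : EuclideanSpace ℝ (Fin n') → M} {g₂ : EuclideanSpace ℝ (Fin n) → M}
    {τ : EuclideanSpace ℝ (Fin n') → EuclideanSpace ℝ (Fin n)} {y : EuclideanSpace ℝ (Fin n')}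
    (hg : g =ᶠ[𝓝 y] g₂ ∘ τ) (hg₂ : MDifferentiableAt (𝓡 n) (𝓡 n) g₂ (τ y))
    (hτ : DifferentiableAt ℝ τ y) :
    (α (g y)).compContinuousLinearMap (mfderiv (𝓡 n') (𝓡 n) g y) =
      ((α (g₂ (τ y))).compContinuousLinearMap
        (mfderiv (𝓡 n) (𝓡 n) g₂ (τ y))).compContinuousLinearMap (fderiv ℝ τ y) := by
  refine compContinuousLinearMap_congr α hg.eq_of_nhds _
    ((mfderiv (𝓡 n) (𝓡 n) g₂ (τ y)).comp (fderiv ℝ τ y)) fun v => ?_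
  have h1 := hg.mfderiv_eq (I := 𝓡 n') (I' := 𝓡 n)
  have h2 := mfderiv_comp y hg₂ hτ.mdifferentiableAt
  rw [h1, h2, mfderiv_eq_fderiv]
  rfl

section Maximal

variable {e e' : OpenPartialHomeomorph M (EuclideanSpace ℝ (Fin n))}

theorem contDiffAt_transition {r : WithTop ℕ∞}
    (he : e ∈ IsManifold.maximalAtlas (𝓡 n) r M)
    (he' : e' ∈ IsManifold.maximalAtlas (𝓡 n) r M) {y : EuclideanSpace ℝ (Fin n)}
    (hy : y ∈ e'.target) (hy' : e'.symm y ∈ e.source) :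
    ContDiffAt ℝ r (fun z => e (e'.symm z)) y :=
  contMDiffAt_iff_contDiffAt.1 ((contMDiffAt_of_mem_maximalAtlas he hy').comp y
    (contMDiffAt_symm_of_mem_maximalAtlas he' hy))

theorem mdifferentiableAt_chart (he : e ∈ IsManifold.maximalAtlas (𝓡 n) 2 M) {p : M}
    (hp : p ∈ e.source) : MDifferentiableAt (𝓡 n) (𝓡 n) e p :=
  (contMDiffAt_of_mem_maximalAtlas he hp).mdifferentiableAt two_ne_zero

theorem mdifferentiableAt_chart_symm (he : e ∈ IsManifold.maximalAtlas (𝓡 n) 2 M)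
    {y : EuclideanSpace ℝ (Fin n)} (hy : y ∈ e.target) :
    MDifferentiableAt (𝓡 n) (𝓡 n) e.symm y :=
  (contMDiffAt_symm_of_mem_maximalAtlas he hy).mdifferentiableAt two_ne_zero

/-- The representations of a form in two charts are related by the pullback along the transition
map. -/
theorem coordRep_eq_pullback (he : e ∈ IsManifold.maximalAtlas (𝓡 n) 2 M)
    (he' : e' ∈ IsManifold.maximalAtlas (𝓡 n) 2 M) (α : Form n M k)
    {y : EuclideanSpace ℝ (Fin n)} (hy : y ∈ e'.target) (hy' : e'.symm y ∈ e.source) :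
    coordRep e' α y = (coordRep e α (e (e'.symm y))).compContinuousLinearMap
      (fderiv ℝ (fun z => e (e'.symm z)) y) := by
  refine pullback_eq_of_eventuallyEq_comp α (τ := fun z => e (e'.symm z)) ?_
    (mdifferentiableAt_chart_symm he (e.map_source hy'))
    ((contDiffAt_transition he he' hy hy').differentiableAt two_ne_zero)
  filter_upwards [eventually_mem_overlap hy hy'] with z hz
  exact (e.left_inv hz.2).symm

open Classical in
/-- The form on `M` that vanishes outside the domain of the chart `e` and whose representation
in `e` is `η`. -/
def ofCoord (e : OpenPartialHomeomorph M (EuclideanSpace ℝ (Fin n)))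
    (η : EuclideanSpace ℝ (Fin n) → EuclideanSpace ℝ (Fin n) [⋀^Fin k]→L[ℝ] ℝ) : Form n M k :=
  fun p => if p ∈ e.source then
    (η (e p)).compContinuousLinearMap (mfderiv (𝓡 n) (𝓡 n) e p) else 0

theorem ofCoord_of_mem
    (η : EuclideanSpace ℝ (Fin n) → EuclideanSpace ℝ (Fin n) [⋀^Fin k]→L[ℝ] ℝ) {p : M}
    (hp : p ∈ e.source) :
    ofCoord e η p = (η (e p)).compContinuousLinearMap (mfderiv (𝓡 n) (𝓡 n) e p) := if_pos hp

theorem ofCoord_of_notMem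
    (η : EuclideanSpace ℝ (Fin n) → EuclideanSpace ℝ (Fin n) [⋀^Fin k]→L[ℝ] ℝ) {p : M}
    (hp : p ∉ e.source) : ofCoord e η p = 0 := if_neg hp

theorem ofCoord_eq_zero
    {η : EuclideanSpace ℝ (Fin n) → EuclideanSpace ℝ (Fin n) [⋀^Fin k]→L[ℝ] ℝ} {p : M}
    (hp : p ∈ e.source → η (e p) = 0) : ofCoord e η p = 0 := by
  by_cases h : p ∈ e.source
  · rw [ofCoord_of_mem η h, hp h]
    rfl
  · exact ofCoord_of_notMem η h

theorem mfderiv_chart_comp_symm (he : e ∈ IsManifold.maximalAtlas (𝓡 n) 2 M)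
    {y : EuclideanSpace ℝ (Fin n)} (hy : y ∈ e.target) (v : EuclideanSpace ℝ (Fin n)) :
    (mfderiv (𝓡 n) (𝓡 n) e (e.symm y) (mfderiv (𝓡 n) (𝓡 n) e.symm y v) :
      EuclideanSpace ℝ (Fin n)) = v := by
  have hM : e.MDifferentiable (𝓡 n) (𝓡 n) :=
    ⟨fun p hp => (mdifferentiableAt_chart he hp).mdifferentiableWithinAt,
      fun y hy => (mdifferentiableAt_chart_symm he hy).mdifferentiableWithinAt⟩
  exact DFunLike.congr_fun (hM.comp_symm_deriv hy) v

theorem mfderiv_chart_symm_comp (he : e ∈ IsManifold.maximalAtlas (𝓡 n) 2 M)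
    {p : M} (hp : p ∈ e.source) (v : TangentSpace (𝓡 n) p) :
    (mfderiv (𝓡 n) (𝓡 n) e.symm (e p) (mfderiv (𝓡 n) (𝓡 n) e p v) :
      EuclideanSpace ℝ (Fin n)) = v := by
  have hM : e.MDifferentiable (𝓡 n) (𝓡 n) :=
    ⟨fun p hp => (mdifferentiableAt_chart he hp).mdifferentiableWithinAt,
      fun y hy => (mdifferentiableAt_chart_symm he hy).mdifferentiableWithinAt⟩
  exact DFunLike.congr_fun (hM.symm_comp_deriv hp) v

theorem coordRep_ofCoord (he : e ∈ IsManifold.maximalAtlas (𝓡 n) 2 M)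
    (η : EuclideanSpace ℝ (Fin n) → EuclideanSpace ℝ (Fin n) [⋀^Fin k]→L[ℝ] ℝ)
    {y : EuclideanSpace ℝ (Fin n)} (hy : y ∈ e.target) : coordRep e (ofCoord e η) y = η y := by
  ext v
  rw [coordRep, ofCoord_of_mem η (e.map_target hy)]
  change η (e (e.symm y)) (fun i => mfderiv (𝓡 n) (𝓡 n) e (e.symm y)
    (mfderiv (𝓡 n) (𝓡 n) e.symm y (v i))) = η y v
  rw [e.right_inv hy]
  exact congrArg (η y) (funext fun i => mfderiv_chart_comp_symm he hy (v i))

theorem coordRep_comp_mfderiv_chart (he : e ∈ IsManifold.maximalAtlas (𝓡 n) 2 M)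
    (α : Form n M k) {p : M} (hp : p ∈ e.source) :
    (coordRep e α (e p)).compContinuousLinearMap (mfderiv (𝓡 n) (𝓡 n) e p) = α p := by
  refine (compContinuousLinearMap_congr α (e.left_inv hp)
    ((mfderiv (𝓡 n) (𝓡 n) e.symm (e p)).comp (mfderiv (𝓡 n) (𝓡 n) e p))
    (ContinuousLinearMap.id ℝ _) fun v => mfderiv_chart_symm_comp he hp v).trans ?_
  rfl

theorem coordRep_ofCoord_eq_pullback (he : e ∈ IsManifold.maximalAtlas (𝓡 n) 2 M)
    (he' : e' ∈ IsManifold.maximalAtlas (𝓡 n) 2 M)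
    (η : EuclideanSpace ℝ (Fin n) → EuclideanSpace ℝ (Fin n) [⋀^Fin k]→L[ℝ] ℝ)
    {y : EuclideanSpace ℝ (Fin n)} (hy : y ∈ e'.target) (hy' : e'.symm y ∈ e.source) :
    coordRep e' (ofCoord e η) y = (η (e (e'.symm y))).compContinuousLinearMap
      (fderiv ℝ (fun z => e (e'.symm z)) y) := by
  rw [coordRep_eq_pullback he he' _ hy hy', coordRep_ofCoord he η (e.map_source hy')]

theorem coordRep_eq_zero {α : Form n M k} {y : EuclideanSpace ℝ (Fin n)}
    (h : α (e.symm y) = 0) : coordRep e α y = 0 := by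
  rw [coordRep, h]
  rfl

theorem contDiffAt_coordRep_ofCoord (he : e ∈ IsManifold.maximalAtlas (𝓡 n) 2 M)
    (he' : e' ∈ IsManifold.maximalAtlas (𝓡 n) 2 M)
    {η : EuclideanSpace ℝ (Fin n) → EuclideanSpace ℝ (Fin n) [⋀^Fin k]→L[ℝ] ℝ}
    {r : WithTop ℕ∞} (hr : r ≤ 1) {y : EuclideanSpace ℝ (Fin n)} (hy : y ∈ e'.target)
    (hy' : e'.symm y ∈ e.source) (hη : ContDiffAt ℝ r η (e (e'.symm y))) :
    ContDiffAt ℝ r (coordRep e' (ofCoord e η)) y := by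
  have hτ := contDiffAt_transition he he' hy hy'
  have h : ContDiffAt ℝ r (fun z => (η (e (e'.symm z))).compContinuousLinearMap
      (fderiv ℝ (fun z => e (e'.symm z)) z)) y := by
    refine contDiff_compContinuousLinearMap.contDiffAt.comp y (ContDiffAt.prodMk ?_ ?_)
    · exact hη.comp y (hτ.of_le (hr.trans one_le_two))
    · exact hτ.fderiv_right ((add_le_add_left hr 1).trans_eq one_add_one_eq_two)
  refine h.congr_of_eventuallyEq ?_
  filter_upwards [eventually_mem_overlap hy hy'] with z hz
  exact coordRep_ofCoord_eq_pullback he he' η hz.1 hz.2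

theorem coordRep_pullback {f : M → N}
    (hf : ContMDiff (𝓡 n) (𝓡 n') 1 f) (ω : Form n' N k)
    {c : OpenPartialHomeomorph N (EuclideanSpace ℝ (Fin n'))}
    (he : e ∈ IsManifold.maximalAtlas (𝓡 n) 2 M) (hc : c ∈ IsManifold.maximalAtlas (𝓡 n') 2 N)
    {y : EuclideanSpace ℝ (Fin n)} (hy : y ∈ e.target) (hy' : f (e.symm y) ∈ c.source) :
    coordRep e (pullback f ω) y = (coordRep c ω (c (f (e.symm y)))).compContinuousLinearMap
      (fderiv ℝ (fun z => c (f (e.symm z))) y) := by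
  have hfe : ContMDiffAt (𝓡 n) (𝓡 n') 1 (fun z => f (e.symm z)) y :=
    hf.contMDiffAt.comp y ((contMDiffAt_symm_of_mem_maximalAtlas he hy).of_le one_le_two)
  have hcf : ContDiffAt ℝ 1 (fun z => c (f (e.symm z))) y :=
    contMDiffAt_iff_contDiffAt.1
      (((contMDiffAt_of_mem_maximalAtlas hc hy').of_le one_le_two).comp y hfe)
  have h1 : coordRep e (pullback f ω) y =
      (ω (f (e.symm y))).compContinuousLinearMap
        (mfderiv (𝓡 n) (𝓡 n') (fun z => f (e.symm z)) y) := by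
    refine compContinuousLinearMap_congr ω rfl
      ((mfderiv (𝓡 n) (𝓡 n') f (e.symm y)).comp (mfderiv (𝓡 n) (𝓡 n) e.symm y)) _ fun v => ?_
    have := mfderiv_comp y (hf.mdifferentiableAt one_ne_zero) (mdifferentiableAt_chart_symm he hy)
    exact (DFunLike.congr_fun this v).symm
  rw [h1]
  refine pullback_eq_of_eventuallyEq_comp (g := fun z => f (e.symm z)) ω
    (τ := fun z => c (f (e.symm z))) ?_
    (mdifferentiableAt_chart_symm hc (c.map_source hy')) (hcf.differentiableAt one_ne_zero)
  filter_upwards [hfe.continuousAt.eventually (c.open_source.mem_nhds hy')] with z hz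
  exact (c.left_inv hz).symm

end Maximal

end Charts

section PartialHomeomorph

variable {M H : Type*} [TopologicalSpace M] [TopologicalSpace H]
  {e : OpenPartialHomeomorph M H} {T : Set H}

theorem isCompact_symm_image (hT : IsCompact T) (hTe : T ⊆ e.target) : IsCompact (e.symm '' T) :=
  hT.image_of_continuousOn (e.continuousOn_symm.mono hTe)

theorem symm_image_subset_source (hTe : T ⊆ e.target) : e.symm '' T ⊆ e.source := by
  rintro _ ⟨y, hy, rfl⟩
  exact e.map_target (hTe hy)

end PartialHomeomorph

theorem extDeriv_zero_fun {E : Type*} [NormedAddCommGroup E] [NormedSpace ℝ E] {k : ℕ} (x : E) :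
    extDeriv (fun _ : E => (0 : E [⋀^Fin k]→L[ℝ] ℝ)) x = 0 := by
  rw [extDeriv, fderiv_fun_const]
  exact map_zero (ContinuousAlternatingMap.alternatizeUncurryFinCLM ℝ E ℝ)

section TestForms

variable {n : ℕ} {M : Type*} [TopologicalSpace M] [ChartedSpace (EuclideanSpace ℝ (Fin n)) M]
  {k : ℕ} {e : OpenPartialHomeomorph M (EuclideanSpace ℝ (Fin n))}
  {η : EuclideanSpace ℝ (Fin n) → EuclideanSpace ℝ (Fin n) [⋀^Fin k]→L[ℝ] ℝ}
  {T : Set (EuclideanSpace ℝ (Fin n))}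

theorem ofCoord_eq_zero_of_notMem (hη0 : ∀ y ∉ T, η y = 0) {p : M} (hp : p ∉ e.symm '' T) :
    ofCoord e η p = 0 :=
  ofCoord_eq_zero fun hpe => hη0 _ fun hT => hp ⟨e p, hT, e.left_inv hpe⟩

theorem supp_ofCoord_subset [T2Space M] (hT : IsCompact T) (hTe : T ⊆ e.target)
    (hη0 : ∀ y ∉ T, η y = 0) : supp (ofCoord e η) ⊆ e.symm '' T :=
  closure_minimal (fun _ hp => by_contra fun h => hp (ofCoord_eq_zero_of_notMem hη0 h))
    (isCompact_symm_image hT hTe).isClosed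

theorem isCompact_supp_ofCoord [T2Space M] (hT : IsCompact T) (hTe : T ⊆ e.target)
    (hη0 : ∀ y ∉ T, η y = 0) : IsCompact (supp (ofCoord e η)) :=
  (isCompact_symm_image hT hTe).of_isClosed_subset isClosed_closure
    (supp_ofCoord_subset hT hTe hη0)

theorem coordRep_ofCoord_eventuallyEq_zero [T2Space M] (hT : IsCompact T) (hTe : T ⊆ e.target)
    (hη0 : ∀ y ∉ T, η y = 0) {c : OpenPartialHomeomorph M (EuclideanSpace ℝ (Fin n))}
    {y : EuclideanSpace ℝ (Fin n)} (hy : y ∈ c.target) (hyT : c.symm y ∉ e.symm '' T) :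
    coordRep c (ofCoord e η) =ᶠ[𝓝 y] fun _ => 0 := by
  filter_upwards [(c.continuousAt_symm hy).eventually
    ((isCompact_symm_image hT hTe).isClosed.isOpen_compl.mem_nhds hyT)] with z hz
  exact coordRep_eq_zero (ofCoord_eq_zero_of_notMem hη0 hz)

theorem isCr_one_ofCoord [T2Space M] (he : e ∈ IsManifold.maximalAtlas (𝓡 n) 2 M)
    (hT : IsCompact T) (hTe : T ⊆ e.target) (hη0 : ∀ y ∉ T, η y = 0) (hη : ContDiff ℝ 1 η) :
    IsCr 1 (ofCoord e η) := by
  intro c hc y hy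
  refine ContDiffAt.contDiffWithinAt ?_
  by_cases hyT : c.symm y ∈ e.symm '' T
  · exact contDiffAt_coordRep_ofCoord he hc le_rfl hy.1 (symm_image_subset_source hTe hyT)
      hη.contDiffAt
  · exact contDiffAt_const.congr_of_eventuallyEq
      (coordRep_ofCoord_eventuallyEq_zero hT hTe hη0 hy.1 hyT)

theorem extDeriv_eq_zero_of_notMem (hT : IsClosed T) (hη0 : ∀ y ∉ T, η y = 0)
    {y : EuclideanSpace ℝ (Fin n)} (hy : y ∉ T) : extDeriv η y = 0 := by
  have h : η =ᶠ[𝓝 y] fun _ => 0 := by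
    filter_upwards [hT.isOpen_compl.mem_nhds hy] with z hz using hη0 z hz
  rw [h.extDeriv_eq, extDeriv_zero_fun]

theorem extD_ofCoord [T2Space M] [IsManifold (𝓡 n) 2 M]
    (he : e ∈ IsManifold.maximalAtlas (𝓡 n) 2 M)
    (hT : IsCompact T) (hTe : T ⊆ e.target) (hη0 : ∀ y ∉ T, η y = 0) (hη : ContDiff ℝ 1 η) :
    extD (ofCoord e η) = ofCoord e (extDeriv η) := by
  funext p
  set c := chartAt (EuclideanSpace ℝ (Fin n)) p with hc
  have hcm : c ∈ IsManifold.maximalAtlas (𝓡 n) 2 M := IsManifold.chart_mem_maximalAtlas p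
  have hpc : p ∈ c.source := mem_chart_source _ p
  have hcp : c p ∈ c.target := c.map_source hpc
  by_cases hpT : p ∈ e.symm '' T
  · have hpe := symm_image_subset_source hTe hpT
    have hpe' : c.symm (c p) ∈ e.source := by rwa [c.left_inv hpc]
    have h1 : coordRep c (ofCoord e η) =ᶠ[𝓝 (c p)] fun z =>
        (η (e (c.symm z))).compContinuousLinearMap (fderiv ℝ (fun z => e (c.symm z)) z) := by
      filter_upwards [eventually_mem_overlap hcp hpe'] with z hz
      exact coordRep_ofCoord_eq_pullback he hcm η hz.1 hz.2
    have h2 : extDeriv (coordRep c (ofCoord e η)) (c p) =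
        coordRep c (ofCoord e (extDeriv η)) (c p) := by
      rw [h1.extDeriv_eq, coordRep_ofCoord_eq_pullback he hcm _ hcp hpe']
      exact extDeriv_pullback (hη.differentiable one_ne_zero _)
        (contDiffAt_transition he hcm hcp hpe')
        (by simp only [minSmoothness_of_isRCLikeNormedField]; exact le_rfl)
    rw [extD, ← hc, h2]
    exact coordRep_comp_mfderiv_chart hcm _ hpc
  · have hpT' : c.symm (c p) ∉ e.symm '' T := by rwa [c.left_inv hpc]
    have h1 := coordRep_ofCoord_eventuallyEq_zero hT hTe hη0 hcp hpT'
    have h2 : extDeriv (coordRep c (ofCoord e η)) (c p) = 0 := by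
      rw [h1.extDeriv_eq, extDeriv_zero_fun]
    rw [ofCoord_eq_zero_of_notMem (T := T)
      (fun y hy => extDeriv_eq_zero_of_notMem hT.isClosed hη0 hy) hpT, extD, ← hc, h2]
    rfl

end TestForms

section Top

variable {n : ℕ} {M : Type*} [TopologicalSpace M] [ChartedSpace (EuclideanSpace ℝ (Fin n)) M]
  {e c : OpenPartialHomeomorph M (EuclideanSpace ℝ (Fin n))}

theorem compContinuousLinearMap_apply_basis (a : EuclideanSpace ℝ (Fin n) [⋀^Fin n]→L[ℝ] ℝ)
    (A : EuclideanSpace ℝ (Fin n) →L[ℝ] EuclideanSpace ℝ (Fin n)) :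
    a.compContinuousLinearMap A (fun i => EuclideanSpace.basisFun (Fin n) ℝ i) =
      A.det * a (fun i => EuclideanSpace.basisFun (Fin n) ℝ i) := by
  let b := (EuclideanSpace.basisFun (Fin n) ℝ).toBasis
  have hb : (b : Fin n → EuclideanSpace ℝ (Fin n)) =
      fun i => EuclideanSpace.basisFun (Fin n) ℝ i := by
    funext i
    rw [OrthonormalBasis.coe_toBasis]
  have h := AlternatingMap.eq_smul_basis_det b a.toAlternatingMap
  have h1 := DFunLike.congr_fun h (A ∘ b)
  have h2 := b.det_comp (A : EuclideanSpace ℝ (Fin n) →ₗ[ℝ] EuclideanSpace ℝ (Fin n)) b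
  rw [b.det_self, mul_one] at h2
  rw [← hb]
  change a (A ∘ b) = _
  change a (A ∘ b) = a b * b.det (A ∘ b) at h1
  rw [h1, mul_comm]
  exact congrArg (· * a b) h2

/-- The form representing `dx₁ ∧ … ∧ dxₙ` in the chart `e`. -/
def chartOrientation (e : OpenPartialHomeomorph M (EuclideanSpace ℝ (Fin n))) : Form n M n :=
  ofCoord e fun _ => coordForm id

theorem coordForm_id_basis :
    coordForm id (fun i => EuclideanSpace.basisFun (Fin n) ℝ i) = 1 := by
  rw [coordForm_apply, ← Matrix.det_one (n := Fin n)]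
  congr 1
  ext i j
  simp [Matrix.one_apply, eq_comm]

theorem coeff_eq_det_mul (he : e ∈ IsManifold.maximalAtlas (𝓡 n) 2 M)
    (hc : c ∈ IsManifold.maximalAtlas (𝓡 n) 2 M) (α : Form n M n)
    {y : EuclideanSpace ℝ (Fin n)} (hy : y ∈ c.target) (hy' : c.symm y ∈ e.source) :
    coeff c α y = (fderiv ℝ (fun z => e (c.symm z)) y).det * coeff e α (e (c.symm y)) := by
  rw [coeff, coordRep_eq_pullback he hc α hy hy', compContinuousLinearMap_apply_basis]
  rfl

theorem coeff_chartOrientation (he : e ∈ IsManifold.maximalAtlas (𝓡 n) 2 M)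
    {y : EuclideanSpace ℝ (Fin n)} (hy : y ∈ e.target) :
    coeff e (chartOrientation e) y = 1 := by
  rw [coeff, chartOrientation, coordRep_ofCoord he _ hy, coordForm_id_basis]

theorem isOrientationOn_chartOrientation (he : e ∈ IsManifold.maximalAtlas (𝓡 n) 2 M) :
    IsOrientationOn (chartOrientation e) e.source := by
  refine ⟨e.open_source, fun c hc y hy => ?_, fun p hp h0 => ?_⟩
  · exact (contDiffAt_coordRep_ofCoord he hc zero_le_one hy.1 hy.2
      contDiffAt_const).contDiffWithinAt
  · have h1 := coeff_chartOrientation he (e.map_source hp)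
    have h2 : chartOrientation e (e.symm (e p)) = 0 := by rw [e.left_inv hp, h0]
    rw [coeff, coordRep_eq_zero h2] at h1
    exact zero_ne_one h1

/-- The integral of a top form supported in the domain of a chart can be computed in that chart. -/
theorem integral_chartOrientation [T2Space M] [SecondCountableTopology M] [IsManifold (𝓡 n) 2 M]
    (he : e ∈ IsManifold.maximalAtlas (𝓡 n) 2 M) {T : Set (EuclideanSpace ℝ (Fin n))}
    (hT : IsCompact T) (hTe : T ⊆ e.target) {α : Form n M n} (hα0 : ∀ p ∉ e.symm '' T, α p = 0)
    (hα : ContinuousOn (coeff e α) e.target) :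
    integral (chartOrientation e) α = ∫ y in e.target, coeff e α y := by
  set ρ := chartPartition n M
  have hρ : ρ.IsSubordinate fun p => (chartAt (EuclideanSpace ℝ (Fin n)) p).source :=
    (exists_partitionOfUnity n M).choose_spec
  have hcoeff0 : ∀ (c : OpenPartialHomeomorph M (EuclideanSpace ℝ (Fin n)))
      (y : EuclideanSpace ℝ (Fin n)), c.symm y ∉ e.symm '' T → coeff c α y = 0 := fun c y hy => by
    rw [coeff, coordRep_eq_zero (hα0 _ hy)]
    rfl
  have hpiece : ∀ p : M, (∫ y in (chartAt (EuclideanSpace ℝ (Fin n)) p).target,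
      ρ p ((chartAt (EuclideanSpace ℝ (Fin n)) p).symm y) *
        (SignType.sign (coeff (chartAt (EuclideanSpace ℝ (Fin n)) p) (chartOrientation e) y) : ℝ) *
          coeff (chartAt (EuclideanSpace ℝ (Fin n)) p) α y) =
      ∫ x in e.target, ρ p (e.symm x) * coeff e α x := by
    intro p
    set c := chartAt (EuclideanSpace ℝ (Fin n)) p
    have hc : c ∈ IsManifold.maximalAtlas (𝓡 n) 2 M := IsManifold.chart_mem_maximalAtlas p
    set O := c.target ∩ c.symm ⁻¹' e.source with hO
    have hOopen : IsOpen O := c.symm.isOpen_inter_preimage e.open_source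
    have himage : (fun z => e (c.symm z)) '' O = e.target ∩ e.symm ⁻¹' c.source := by
      ext x
      constructor
      · rintro ⟨y, ⟨hy, hy'⟩, rfl⟩
        refine ⟨e.map_source hy', ?_⟩
        simp only [Set.mem_preimage, e.left_inv hy']
        exact c.map_target hy
      · rintro ⟨hx, hx'⟩
        refine ⟨c (e.symm x), ⟨c.map_source hx', ?_⟩, ?_⟩
        · simp only [Set.mem_preimage, c.left_inv hx']
          exact e.map_target hx
        · simp only [c.left_inv hx', e.right_inv hx]
    have hinj : Set.InjOn (fun z => e (c.symm z)) O := by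
      intro y hy z hz hyz
      exact c.symm.injOn hy.1 hz.1 (e.injOn hy.2 hz.2 hyz)
    have hcv := integral_image_eq_integral_abs_det_fderiv_smul volume hOopen.measurableSet
      (f := fun z => e (c.symm z)) (f' := fderiv ℝ fun z => e (c.symm z))
      (fun y hy => ((contDiffAt_transition he hc hy.1 hy.2).differentiableAt
        two_ne_zero).hasFDerivAt.hasFDerivWithinAt) hinj (fun x => ρ p (e.symm x) * coeff e α x)
    rw [himage] at hcv
    rw [setIntegral_eq_of_subset_of_forall_sdiff_eq_zero e.open_target.measurableSet
      (Set.inter_subset_left : e.target ∩ e.symm ⁻¹' c.source ⊆ e.target), hcv,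
      setIntegral_eq_of_subset_of_forall_sdiff_eq_zero c.open_target.measurableSet
      (Set.inter_subset_left : O ⊆ c.target)]
    · refine setIntegral_congr_fun hOopen.measurableSet fun y hy => ?_
      have h1 := coeff_eq_det_mul he hc α hy.1 hy.2
      have h2 := coeff_eq_det_mul he hc (chartOrientation e) hy.1 hy.2
      rw [coeff_chartOrientation he (e.map_source hy.2), mul_one] at h2
      simp only [h1, h2, smul_eq_mul, e.left_inv hy.2]
      rw [← sign_mul_self]
      ring
    · intro y hy
      rw [hcoeff0 c y fun h => hy.2 ⟨hy.1, symm_image_subset_source hTe h⟩, mul_zero]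
    · intro x hx
      have : e.symm x ∉ tsupport (ρ p) := fun h => hx.2 ⟨hx.1, hρ p h⟩
      rw [image_eq_zero_of_notMem_tsupport this, zero_mul]
  have hfin : {p | (Function.support (ρ p) ∩ e.symm '' T).Nonempty}.Finite :=
    ρ.locallyFinite.finite_nonempty_inter_compact (isCompact_symm_image hT hTe)
  have hzero : ∀ p ∉ hfin.toFinset, ∀ x, ρ p (e.symm x) * coeff e α x = 0 := fun p hp x => by
    by_cases hx : e.symm x ∈ e.symm '' T
    · have : ρ p (e.symm x) = 0 := by
        by_contra hne
        exact hp (hfin.mem_toFinset.2 ⟨_, hne, hx⟩)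
      rw [this, zero_mul]
    · rw [hcoeff0 e x hx, mul_zero]
  have hsum : integral (chartOrientation e) α =
      ∑ p ∈ hfin.toFinset, ∫ x in e.target, ρ p (e.symm x) * coeff e α x := by
    rw [integral]
    refine (finsum_congr hpiece).trans (finsum_eq_sum_of_support_subset _ fun p hp => ?_)
    by_contra hpf
    refine hp ?_
    simp only [hzero p hpf, integral_zero]
  rw [hsum, ← integral_finsetSum]
  · refine setIntegral_congr_fun e.open_target.measurableSet fun x hx => ?_
    rw [← Finset.sum_mul]
    by_cases hxT : e.symm x ∈ e.symm '' T
    · rw [ρ.sum_finsupport' (Set.mem_univ _), one_mul]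
      intro p hp
      exact hfin.mem_toFinset.2 ⟨_, (ρ.mem_finsupport _).1 hp, hxT⟩
    · rw [hcoeff0 e x hxT, mul_zero]
  · intro p _
    have hcont : ContinuousOn (fun x => ρ p (e.symm x) * coeff e α x) e.target :=
      ((ρ p).continuous.comp_continuousOn e.continuousOn_symm).mul hα
    refine IntegrableOn.of_forall_sdiff_eq_zero
      ((hcont.mono hTe).integrableOn_compact hT) e.open_target.measurableSet fun x hx => ?_
    rw [hcoeff0 e x, mul_zero]
    rintro ⟨y, hy, hyx⟩
    exact hx.2 (e.symm.injOn (hTe hy) hx.1 hyx ▸ hy)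

end Top

section Weak

variable {n : ℕ} {M : Type*} [TopologicalSpace M] [ChartedSpace (EuclideanSpace ℝ (Fin n)) M]
  {h L : ℕ} {e : OpenPartialHomeomorph M (EuclideanSpace ℝ (Fin n))}

theorem sum_compContinuousLinearMap {ι X Y : Type*} [Fintype ι] [AddCommGroup X] [Module ℝ X]
    [TopologicalSpace X] [AddCommGroup Y] [Module ℝ Y] [TopologicalSpace Y] {k : ℕ}
    (F : ι → Y [⋀^Fin k]→L[ℝ] ℝ) (g : X →L[ℝ] Y) :
    (∑ s, F s).compContinuousLinearMap g = ∑ s, (F s).compContinuousLinearMap g := by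
  ext v
  simp

/-- The matrix of forms whose entries are represented by `ζ` in the chart `e`. -/
def matOfCoord {l : ℕ} (e : OpenPartialHomeomorph M (EuclideanSpace ℝ (Fin n)))
    (ζ : Fin L → Fin L → EuclideanSpace ℝ (Fin n) → EuclideanSpace ℝ (Fin n) [⋀^Fin l]→L[ℝ] ℝ) :
    MatForm L n M l :=
  Matrix.of fun s t => ofCoord e (ζ s t)

theorem coordRep_matWedge {k l m : ℕ} (hm : k + l = m) (a : MatForm L n M k) (b : MatForm L n M l)
    (i j : Fin L) (y : EuclideanSpace ℝ (Fin n)) :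
    coordRep e (matWedge hm a b i j) y =
      ∑ s : Fin L, wedge hm (coordRep e (a i s) y) (coordRep e (b s j) y) :=
  (sum_compContinuousLinearMap _ _).trans
    (Finset.sum_congr rfl fun _ _ => wedge_compContinuousLinearMap hm _ _ _)

theorem matWedge_eq_zero {k l m : ℕ} (hm : k + l = m) (a : MatForm L n M k) (b : MatForm L n M l)
    (i j : Fin L) {p : M} (hb : ∀ s, b s j p = 0) : matWedge hm a b i j p = 0 := by
  simp only [matWedge, hb]
  exact Finset.sum_eq_zero fun s _ => wedge_zero_right hm _

theorem continuousOn_wedge_apply {X E : Type*} [TopologicalSpace X] [NormedAddCommGroup E]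
    [NormedSpace ℝ E] {k l m : ℕ} (hm : k + l = m) {a : X → E [⋀^Fin k]→L[ℝ] ℝ}
    {b : X → E [⋀^Fin l]→L[ℝ] ℝ} {S : Set X} (ha : ContinuousOn a S) (hb : ContinuousOn b S)
    (v : Fin m → E) : ContinuousOn (fun x => wedge hm (a x) (b x) v) S := by
  simp only [wedge_apply]
  refine continuousOn_const.mul (continuousOn_finsetSum _ fun σ _ => continuousOn_const.mul ?_)
  exact ((ContinuousAlternatingMap.apply ℝ E ℝ _).continuous.comp_continuousOn ha).mul
    ((ContinuousAlternatingMap.apply ℝ E ℝ _).continuous.comp_continuousOn hb)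

theorem IsCr.continuousOn_coordRep {k : ℕ} {α : Form n M k} (hα : IsCr 0 α)
    (he : e ∈ IsManifold.maximalAtlas (𝓡 n) 2 M) : ContinuousOn (coordRep e α) e.target := by
  have := (hα e he).continuousOn
  rwa [Set.preimage_univ, Set.inter_univ] at this

theorem integral_matWedge_ofCoord [T2Space M] [SecondCountableTopology M] [IsManifold (𝓡 n) 2 M]
    (he : e ∈ IsManifold.maximalAtlas (𝓡 n) 2 M) {k l : ℕ} (hm : k + l = n)
    {a : MatForm L n M k} (ha : ∀ i j, IsCr 0 (a i j))
    {ζ : Fin L → Fin L → EuclideanSpace ℝ (Fin n) → EuclideanSpace ℝ (Fin n) [⋀^Fin l]→L[ℝ] ℝ}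
    (hζ : ∀ i j, Continuous (ζ i j)) {T : Set (EuclideanSpace ℝ (Fin n))} (hT : IsCompact T)
    (hTe : T ⊆ e.target) (hζ0 : ∀ i j, ∀ y ∉ T, ζ i j y = 0) (i j : Fin L) :
    integral (chartOrientation e) (matWedge hm a (matOfCoord e ζ) i j) =
      ∫ y in e.target, ∑ s : Fin L, wedge hm (coordRep e (a i s) y) (ζ s j y)
        (fun i => EuclideanSpace.basisFun (Fin n) ℝ i) := by
  have hcoeff : ∀ y ∈ e.target, coeff e (matWedge hm a (matOfCoord e ζ) i j) y =
      ∑ s : Fin L, wedge hm (coordRep e (a i s) y) (ζ s j y)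
        (fun i => EuclideanSpace.basisFun (Fin n) ℝ i) := fun y hy => by
    rw [coeff, coordRep_matWedge, ContinuousAlternatingMap.sum_apply]
    refine Finset.sum_congr rfl fun s _ => ?_
    rw [show coordRep e (matOfCoord e ζ s j) y = ζ s j y from coordRep_ofCoord he _ hy]
  rw [integral_chartOrientation he hT hTe]
  · exact setIntegral_congr_fun e.open_target.measurableSet hcoeff
  · exact fun p hp => matWedge_eq_zero hm _ _ i j fun s =>
      ofCoord_eq_zero_of_notMem (hζ0 s j) hp
  · refine ContinuousOn.congr ?_ hcoeff
    refine continuousOn_finsetSum _ fun s _ => ?_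
    exact continuousOn_wedge_apply hm ((ha i s).continuousOn_coordRep he)
      (hζ s j).continuousOn _

/-- In a chart, the distributional exterior derivative is a weak exterior derivative, tested
against scalar functions. -/
theorem IsDED.integral_covecWedge_add_smul [T2Space M] [SecondCountableTopology M]
    [IsManifold (𝓡 n) 2 M] (hn : h + 1 ≤ n) {μ : MatForm L n M h} {δ : MatForm L n M (h + 1)}
    (hμ : ∀ i j, IsCr 0 (μ i j)) (hδ : ∀ i j, IsCr 0 (δ i j)) (hded : IsDED μ δ)
    (he : e ∈ IsManifold.maximalAtlas (𝓡 n) 2 M) (i s : Fin L)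
    {χ : EuclideanSpace ℝ (Fin n) → ℝ} (hχ : ContDiff ℝ (⊤ : ℕ∞) χ) (hχc : HasCompactSupport χ)
    (hχe : tsupport χ ⊆ e.target) :
    ∫ y, (covecWedge (fderiv ℝ χ y) (coordRep e (μ i s) y) + χ y • coordRep e (δ i s) y) = 0 := by
  obtain ⟨q, hq⟩ := Nat.exists_eq_add_of_le hn
  have hq : h + 1 + q = n := hq.symm
  have hq' : h + (q + 1) = n := by omega
  have hχ1 : ContDiff ℝ 1 χ := hχ.of_le (by simp)
  have hμc := (hμ i s).continuousOn_coordRep he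
  have hδc := (hδ i s).continuousOn_coordRep he
  have hint1 : Integrable fun y => covecWedge (fderiv ℝ χ y) (coordRep e (μ i s) y) :=
    integrable_covecWedge e.open_target hχ1 hχc hχe hμc
  have hint2 : Integrable fun y => χ y • coordRep e (δ i s) y :=
    integrable_smul_form e.open_target hχ.continuous hχc hχe hδc
  refine eq_zero_of_wedge_eq_zero hq _ fun c => ?_
  set b : Fin n → EuclideanSpace ℝ (Fin n) := fun i => EuclideanSpace.basisFun (Fin n) ℝ i
  rw [← wedgeCLM_apply, ← ContinuousLinearMap.integral_comp_comm _ (hint1.add hint2)]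
  let ζ : Fin L → Fin L → EuclideanSpace ℝ (Fin n) → EuclideanSpace ℝ (Fin n) [⋀^Fin q]→L[ℝ] ℝ :=
    fun t _ y => (if t = s then χ y else 0) • c
  have hif : ∀ t, ContDiff ℝ 1 fun y => if t = s then χ y else 0 := fun t => by
    split_ifs
    · exact hχ1
    · exact contDiff_const
  have hζ : ∀ t j, ContDiff ℝ 1 (ζ t j) := fun t j => (hif t).smul contDiff_const
  have hζ0 : ∀ t j, ∀ y ∉ tsupport χ, ζ t j y = 0 := fun t j y hy => by
    simp [ζ, image_eq_zero_of_notMem_tsupport hy]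
  have hdζ : ∀ t j y, extDeriv (ζ t j) y = if t = s then covecWedge (fderiv ℝ χ y) c else 0 := by
    intro t j y
    by_cases hts : t = s
    · simp only [ζ, hts, if_true]
      rw [extDeriv_smul_fun (hχ1.differentiable one_ne_zero y) (differentiableAt_const c)]
      have : extDeriv (fun _ => c) y = 0 := by
        rw [extDeriv, fderiv_fun_const]
        exact map_zero (ContinuousAlternatingMap.alternatizeUncurryFinCLM ℝ _ ℝ)
      rw [this, smul_zero, add_zero]
    · simp only [ζ, hts, if_false, zero_smul, extDeriv_zero_fun]
  have key := hded e.source (chartOrientation e) (isOrientationOn_chartOrientation he) q hq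
    (matOfCoord e ζ) (fun t j => ⟨isCr_one_ofCoord he hχc hχe (hζ0 t j) (hζ t j),
      isCompact_supp_ofCoord hχc hχe (hζ0 t j),
      (supp_ofCoord_subset hχc hχe (hζ0 t j)).trans (symm_image_subset_source hχe)⟩) i s
  have hmap : (matOfCoord (M := M) e ζ).map extD = matOfCoord e fun t j => extDeriv (ζ t j) := by
    refine Matrix.ext fun t j => ?_
    exact extD_ofCoord he hχc hχe (hζ0 t j) (hζ t j)
  rw [hmap, integral_matWedge_ofCoord he hq' hμ (fun t j => continuous_extDeriv (hζ t j)) hχc hχe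
      (fun t j y hy => extDeriv_eq_zero_of_notMem hχc.isClosed (hζ0 t j) hy),
    integral_matWedge_ofCoord he hq hδ (fun t j => (hζ t j).continuous) hχc hχe hζ0] at key
  have hL : ∀ y, ∑ t, wedge hq' (coordRep e (μ i t) y) (extDeriv (ζ t s) y) b =
      (-1) ^ h * wedgeCLM hq c b (covecWedge (fderiv ℝ χ y) (coordRep e (μ i s) y)) := fun y => by
    rw [Finset.sum_eq_single s]
    · rw [hdζ _ s, if_pos rfl, wedge_covecWedge hq' hq]
      rfl
    · intro t _ hts
      rw [hdζ _ s, if_neg hts, wedge_zero_right]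
      rfl
    · simp
  have hR : ∀ y, ∑ t, wedge hq (coordRep e (δ i t) y) (ζ t s y) b =
      wedgeCLM hq c b (χ y • coordRep e (δ i s) y) := fun y => by
    rw [Finset.sum_eq_single s]
    · simp only [ζ, if_true, wedge_smul_right, map_smul]
      rfl
    · intro t _ hts
      simp only [ζ, if_neg hts, zero_smul, wedge_zero_right]
      rfl
    · simp
  simp only [b] at hL hR
  simp only [hL, hR] at key
  rw [integral_const_mul] at key
  have hs1 : ∀ y ∉ e.target, wedgeCLM hq c b
      (covecWedge (fderiv ℝ χ y) (coordRep e (μ i s) y)) = 0 := fun y hy => by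
    rw [fderiv_eq_zero_of_notMem_tsupport fun h => hy (hχe h), covecWedge_zero_left, map_zero]
  have hs2 : ∀ y ∉ e.target, wedgeCLM hq c b (χ y • coordRep e (δ i s) y) = 0 := fun y hy => by
    rw [image_eq_zero_of_notMem_tsupport fun h => hy (hχe h), zero_smul, map_zero]
  rw [setIntegral_eq_integral_of_forall_compl_eq_zero hs1,
    setIntegral_eq_integral_of_forall_compl_eq_zero hs2] at key
  simp only [map_add]
  rw [integral_add ((wedgeCLM hq c b).integrable_comp hint1)
    ((wedgeCLM hq c b).integrable_comp hint2)]
  have hne : ((-1 : ℝ) ^ h) ≠ 0 := pow_ne_zero _ (by norm_num)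
  apply mul_left_cancel₀ hne
  rw [mul_add, key, pow_succ]
  ring

end Weak

/-- A map that is `C^1` on a neighbourhood of a point agrees near the point with a compactly
supported `C^1` map. -/
theorem exists_contDiff_hasCompactSupport_eqOn_ball {E W : Type*} [NormedAddCommGroup E]
    [InnerProductSpace ℝ E] [FiniteDimensional ℝ E] [NormedAddCommGroup W] [NormedSpace ℝ W]
    {U : Set E} (hU : IsOpen U) {x : E} (hx : x ∈ U) {g : E → W} (hg : ContDiffOn ℝ 1 g U) :
    ∃ g₁ : E → W, ContDiff ℝ 1 g₁ ∧ HasCompactSupport g₁ ∧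
      ∃ r > 0, Metric.ball x r ⊆ U ∧ Set.EqOn g₁ g (Metric.ball x r) := by
  obtain ⟨R, hR, hRU⟩ := Metric.nhds_basis_closedBall.mem_iff.1 (hU.mem_nhds hx)
  let b : ContDiffBump x := ⟨R / 2, R, by positivity, by linarith⟩
  have hb : ContDiff ℝ 1 b := b.contDiff
  refine ⟨fun y => b y • g y, ?_, b.hasCompactSupport.smul_right, R / 2, by positivity,
    (Metric.ball_subset_ball (by linarith)).trans (Metric.ball_subset_closedBall.trans hRU), ?_⟩
  · refine contDiff_iff_contDiffAt.2 fun y => ?_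
    by_cases hy : y ∈ tsupport b
    · rw [b.tsupport_eq] at hy
      exact hb.contDiffAt.smul (hg.contDiffAt (hU.mem_nhds (hRU hy)))
    · refine (contDiffAt_const (c := (0 : W))).congr_of_eventuallyEq ?_
      filter_upwards [(isClosed_tsupport b).isOpen_compl.mem_nhds hy] with z hz
      rw [image_eq_zero_of_notMem_tsupport hz, zero_smul]
  · intro y hy
    simp only [b.one_of_mem_closedBall (Metric.ball_subset_closedBall hy), one_smul]

section Main

variable {n n' h : ℕ} {M : Type*} [TopologicalSpace M] [ChartedSpace (EuclideanSpace ℝ (Fin n)) M]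
  {N : Type*} [TopologicalSpace N] [ChartedSpace (EuclideanSpace ℝ (Fin n')) N]

theorem coordRep_extD [IsManifold (𝓡 n) 2 M] (ω : Form n M h) (p : M) :
    coordRep (chartAt (EuclideanSpace ℝ (Fin n)) p) (extD ω)
        (chartAt (EuclideanSpace ℝ (Fin n)) p p) =
      extDeriv (coordRep (chartAt (EuclideanSpace ℝ (Fin n)) p) ω)
        (chartAt (EuclideanSpace ℝ (Fin n)) p p) := by
  set c := chartAt (EuclideanSpace ℝ (Fin n)) p with hc
  have hp : p ∈ c.source := mem_chart_source _ p
  have h1 : extD ω p = ofCoord c (extDeriv (coordRep c ω)) p := by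
    rw [ofCoord_of_mem _ hp]
    rfl
  have h2 : extD ω (c.symm (c p)) = ofCoord c (extDeriv (coordRep c ω)) (c.symm (c p)) := by
    rw [c.left_inv hp, h1]
  rw [← coordRep_ofCoord (IsManifold.chart_mem_maximalAtlas p)
    (extDeriv (coordRep c ω)) (c.map_source hp), coordRep, h2]
  rfl

theorem isLittleO_chart_of_mem_densityPoints [IsManifold (𝓡 n) 1 M] {A : Set M} {Q : M}
    (hQ : Q ∈ densityPoints n ((n : ℝ) + 1) A)
    {e : OpenPartialHomeomorph M (EuclideanSpace ℝ (Fin n))}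
    (he : e ∈ IsManifold.maximalAtlas (𝓡 n) 1 M) (hQe : Q ∈ e.source)
    {Z : Set (EuclideanSpace ℝ (Fin n))} (hZ : ∀ᶠ x in 𝓝 (e Q), e.symm x ∈ A → x ∈ Z) :
    (fun r : ℝ => (volume (Metric.ball (e Q) r \ Z)).toReal) =o[𝓝[>] 0]
      fun r : ℝ => r ^ (n + 1) := by
  obtain ⟨g, hg, hQg, hlit⟩ := hQ
  have hQe' : e.symm (e Q) ∈ g.source := by rwa [e.left_inv hQe]
  have hQg' : g.symm (g Q) ∈ e.source := by rwa [g.left_inv hQg]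
  refine isLittleO_density_transfer (T := fun x => g (e.symm x)) (S := fun x => e (g.symm x))
    (y₀ := g Q) (B := g '' (A ∩ g.source))
    (contDiffAt_transition hg he (e.map_source hQe) hQe')
    (contDiffAt_transition he hg (g.map_source hQg) hQg') (by simp only [e.left_inv hQe]) ?_ ?_ ?_
  · filter_upwards [eventually_mem_overlap (e.map_source hQe) hQe'] with x hx
    simp only [g.left_inv hx.2, e.right_inv hx.1]
  · filter_upwards [eventually_mem_overlap (e.map_source hQe) hQe', hZ] with x hx hxZ
    rintro ⟨p, ⟨hpA, hpg⟩, hpx⟩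
    exact hxZ (g.injOn hpg hx.2 hpx ▸ hpA)
  · refine hlit.congr_right fun r => ?_
    exact_mod_cast Real.rpow_natCast r (n + 1)

end Main

end ManifoldForms
end

theorem corollary3p1 {n n' h L : ℕ}
    {M : Type*} [TopologicalSpace M] [T2Space M] [SecondCountableTopology M]
    [ChartedSpace (EuclideanSpace ℝ (Fin n)) M] [IsManifold (𝓡 n) 2 M]
    {N : Type*} [TopologicalSpace N] [T2Space N] [SecondCountableTopology N]
    [ChartedSpace (EuclideanSpace ℝ (Fin n')) N] [IsManifold (𝓡 n') 2 N]
    (hn : h + 1 ≤ n)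
    (f : M → N) (hf : ContMDiff (𝓡 n) (𝓡 n') 1 f)
    (ω : ManifoldForms.MatForm L n' N h) (hω : ∀ i j, ManifoldForms.IsCr 1 (ω i j))
    (μ : ManifoldForms.MatForm L n M h) (hμ : ∀ i j, ManifoldForms.IsCr 0 (μ i j))
    (δμ : ManifoldForms.MatForm L n M (h + 1)) (hδμ : ∀ i j, ManifoldForms.IsCr 0 (δμ i j))
    (hded : ManifoldForms.IsDED μ δμ)
    (Q : M)
    (hQ : Q ∈ ManifoldForms.densityPoints n ((n : ℝ) + 1)
      {P : M | ∀ i j, μ i j P = ManifoldForms.pullback f (ω i j) P}) :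
    ∀ i j, δμ i j Q = ManifoldForms.pullback f (ManifoldForms.extD (ω i j)) Q := by
  open ManifoldForms MeasureTheory Filter in
  intro i j
  have : IsManifold (𝓡 n) 1 M := IsManifold.of_le (n := 2) one_le_two
  set e := chartAt (EuclideanSpace ℝ (Fin n)) Q
  set c := chartAt (EuclideanSpace ℝ (Fin n')) (f Q)
  have he : e ∈ IsManifold.maximalAtlas (𝓡 n) 2 M := IsManifold.chart_mem_maximalAtlas Q
  have hc : c ∈ IsManifold.maximalAtlas (𝓡 n') 2 N := IsManifold.chart_mem_maximalAtlas (f Q)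
  have hQe : Q ∈ e.source := mem_chart_source _ Q
  have hQt : e Q ∈ e.target := e.map_source hQe
  have hQc : f (e.symm (e Q)) ∈ c.source := by
    rw [e.left_inv hQe]
    exact mem_chart_source _ (f Q)
  set f₀ : EuclideanSpace ℝ (Fin n) → EuclideanSpace ℝ (Fin n') := fun z => c (f (e.symm z))
  have hf₀Q : f₀ (e Q) = c (f Q) := by simp only [f₀, e.left_inv hQe]
  set ω₀ := coordRep c (ω i j)
  set U := e.target ∩ (fun z => f (e.symm z)) ⁻¹' c.source
  have hfe : ContinuousOn (fun z => f (e.symm z)) e.target :=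
    hf.continuous.comp_continuousOn e.continuousOn_symm
  have hU : IsOpen U := hfe.isOpen_inter_preimage e.open_target c.open_source
  have hf₀ : ContDiffOn ℝ 1 f₀ U := fun y hy => by
    refine (contMDiffAt_iff_contDiffAt.1 ?_).contDiffWithinAt
    exact ((contMDiffAt_of_mem_maximalAtlas hc hy.2).of_le one_le_two).comp y
      (hf.contMDiffAt.comp y ((contMDiffAt_symm_of_mem_maximalAtlas he hy.1).of_le one_le_two))
  have hω₀ : ContDiffOn ℝ 1 ω₀ c.target := by
    have := hω i j c hc
    rwa [Set.preimage_univ, Set.inter_univ] at this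
  obtain ⟨f₁, hf₁, hf₁c, r₁, hr₁, hr₁U, hf₁₀⟩ :=
    exists_contDiff_hasCompactSupport_eqOn_ball hU ⟨hQt, hQc⟩ hf₀
  obtain ⟨ω₁, hω₁, -, r₂, hr₂, -, hω₁₀⟩ :=
    exists_contDiff_hasCompactSupport_eqOn_ball c.open_target (c.map_source hQc) hω₀
  set V := Metric.ball (e Q) r₁ ∩ f₀ ⁻¹' Metric.ball (f₀ (e Q)) r₂
  have hV : IsOpen V := (hf₀.continuousOn.mono hr₁U).isOpen_inter_preimage Metric.isOpen_ball
    Metric.isOpen_ball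
  have hQV : e Q ∈ V := ⟨Metric.mem_ball_self hr₁, Metric.mem_ball_self hr₂⟩
  have hVe : V ⊆ e.target := fun x hx => (hr₁U hx.1).1
  have hf₁V : ∀ x ∈ V, f₁ x = f₀ x ∧ fderiv ℝ f₁ x = fderiv ℝ f₀ x := fun x hx =>
    ⟨hf₁₀ hx.1, (hf₁₀.eventuallyEq_of_mem (Metric.isOpen_ball.mem_nhds hx.1)).fderiv_eq⟩
  have hpull : ∀ x ∈ V, coordRep e (pullback f (ω i j)) x =
      (ω₁ (f₁ x)).compContinuousLinearMap (fderiv ℝ f₁ x) := fun x hx => by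
    rw [coordRep_pullback hf (ω i j) he hc (hVe hx) (hr₁U hx.1).2, (hf₁V x hx).1, (hf₁V x hx).2,
      hω₁₀ hx.2]
  have hcont₁ : Continuous fun x => (ω₁ (f₁ x)).compContinuousLinearMap (fderiv ℝ f₁ x) :=
    continuous_compContinuousLinearMap.comp
      ((hω₁.continuous.comp hf₁.continuous).prodMk (hf₁.continuous_fderiv one_ne_zero))
  have hcont₂ : Continuous fun x => (extDeriv ω₁ (f₁ x)).compContinuousLinearMap (fderiv ℝ f₁ x) :=
    continuous_compContinuousLinearMap.comp
      (((continuous_extDeriv hω₁).comp hf₁.continuous).prodMk (hf₁.continuous_fderiv one_ne_zero))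
  have hμc := ((hμ i j).continuousOn_coordRep he).mono hVe
  have hδc := ((hδμ i j).continuousOn_coordRep he).mono hVe
  have hzero : coordRep e (δμ i j) (e Q) -
      (extDeriv ω₁ (f₁ (e Q))).compContinuousLinearMap (fderiv ℝ f₁ (e Q)) = 0 := by
    refine eq_zero_of_weak_of_density (ν := volume) hV hQV
      (η := fun x => coordRep e (μ i j) x -
        (ω₁ (f₁ x)).compContinuousLinearMap (fderiv ℝ f₁ x))
      (θ := fun x => coordRep e (δμ i j) x -
        (extDeriv ω₁ (f₁ x)).compContinuousLinearMap (fderiv ℝ f₁ x))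
      (hμc.sub hcont₁.continuousOn) (hδc.sub hcont₂.continuousOn) (fun χ hχ hχc hχV => ?_) ?_
    · have hχ1 : ContDiff ℝ 1 χ := hχ.of_le (by simp)
      have h1 := IsDED.integral_covecWedge_add_smul hn hμ hδμ hded he i j hχ hχc (hχV.trans hVe)
      have h2 := integral_covecWedge_pullback (ν := volume) hf₁ hf₁c hω₁ hχ1 hχc
      rw [← sub_zero (0 : EuclideanSpace ℝ (Fin n) [⋀^Fin (h + 1)]→L[ℝ] ℝ)]
      nth_rewrite 1 [← h1]
      rw [← h2, ← integral_sub]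
      · refine integral_congr_ae (Eventually.of_forall fun x => ?_)
        simp only [covecWedge_sub, smul_sub]
        abel
      · exact (integrable_covecWedge hV hχ1 hχc hχV hμc).add
          (integrable_smul_form hV hχ.continuous hχc hχV hδc)
      · exact (integrable_covecWedge hV hχ1 hχc hχV hcont₁.continuousOn).add
          (integrable_smul_form hV hχ.continuous hχc hχV hcont₂.continuousOn)
    · rw [finrank_euclideanSpace_fin]
      refine isLittleO_chart_of_mem_densityPoints hQ (IsManifold.chart_mem_maximalAtlas Q) hQe ?_
      filter_upwards [hV.mem_nhds hQV] with x hx hxA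
      have h3 : coordRep e (μ i j) x = coordRep e (pullback f (ω i j)) x := by
        rw [coordRep, hxA i j]
        rfl
      exact sub_eq_zero.2 (h3.trans (hpull x hx))
  have hωQ : extDeriv ω₁ (f₀ (e Q)) = extDeriv ω₀ (f₀ (e Q)) :=
    (hω₁₀.eventuallyEq_of_mem (Metric.ball_mem_nhds _ hr₂)).extDeriv_eq
  have hfinal : coordRep e (δμ i j) (e Q) = coordRep e (pullback f (extD (ω i j))) (e Q) := by
    rw [sub_eq_zero.1 hzero, coordRep_pullback hf _ he hc hQt hQc, (hf₁V _ hQV).1,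
      (hf₁V _ hQV).2, hωQ]
    congr 1
    rw [show c (f (e.symm (e Q))) = c (f Q) from hf₀Q, hf₀Q]
    exact (coordRep_extD (ω i j) (f Q)).symm
  rw [← coordRep_comp_mfderiv_chart he (δμ i j) hQe, hfinal]
  exact coordRep_comp_mfderiv_chart he _ hQe
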